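/- Setting. Let $N,L$ be non-negative integers and let time be slotted, $t\in\{0,1,2,\dots\}$. The timeline of each system $n\in\{1,\dots,N\}$ is divided into back-to-back renewal frames: $t^n_0=0$, the $k$-th frame is $\mathcal T^n_k=\{t^n_k,\dots,t^n_{k+1}-1\}$, and $T^n_k=t^n_{k+1}-t^n_k\ge 1$. At time $t^n_k$ system $n$ chooses a (possibly random and history-dependent) action $\alpha^n_k$ in a set $\mathcal A^n$ (equipped with a $\sigma$-algebra). In each slot $t$ it incurs a penalty $y^n[t]\in\mathbb R$ and a vector of performance metrics $\mathbf z^n[t]=(z^n_1[t],\dots,z^n_L[t])\in\mathbb R^L$. An external process $\{\mathbf d[t]\}_{t\ge0}\subseteq\mathbb R^L$ is i.i.d. with a given law, $\mathbf d[t]$ being independent of the information from the slots before $t$, and $d_l:=\mathbb E[d_l[t]]$. The renewal property holds: given $\alpha^n_k=\alpha$, the frame $\big(T^n_k,(y^n[t],\mathbf z^n[t])_{t\in\mathcal T^n_k}\big)$ is independent of the information of all systems (and of the external process) from the slots before $t^n_k$, and its law depends only on $n$ and $\alpha$ (measurably on $\alpha$). Let $f_*$ be the infimum of $$\limsup_{T\to\infty}\frac1T\sum_{t=0}^{T-1}\sum_{n=1}^N\mathbb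 E\big[y^n[t]\big]$$ over all processes arising in this way, on all probability spaces, that satisfy $$\limsup_{T\to\infty}\frac1T\sum_{t=0}^{T-1}\sum_{n=1}^N\mathbb E\big[z^n_l[t]\big]\le d_l,\qquad l\in\{1,\dots,L\}.\tag{1}$$ For $\alpha\in\mathcal A^n$ put $\widehat y^n(\alpha)=\mathbb E\big[\sum_{t\in\mathcal T^n_k}y^n[t]\,\big|\,\alpha^n_k=\alpha\big]$, $\widehat z^n_l(\alpha)=\mathbb E\big[\sum_{t\in\mathcal T^n_k}z^n_l[t]\,\big|\,\alpha^n_k=\alpha\big]$, $\widehat{\mathbf z}^n(\alpha)=(\widehat z^n_1(\alpha),\dots,\widehat z^n_L(\alpha))$ and $\widehat T^n(\alpha)=\mathbb E[T^n_k\mid\alpha^n_k=\alpha]$. Let $\mathcal S^n\subseteq\mathbb R^{L+2}$ be the convex hull of $\{(\widehat y^n(\alpha),\widehat{\mathbf z}^n(\alpha),\widehat T^n(\alpha)):\alpha\in\mathcal A^n\}$ and let $$\mathcal P^n=\{(y/T,\mathbf z/T):(y,\mathbf z,T)\in\mathcal S^n\}\subseteq\mathbb R^{L+1}$$ be the performance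 region of system $n$. Assume: (a) (Feasibility) some process as above satisfies (1). (b) (Boundedness) there are constants $y_{\max},z_{\max},d_{\max}$ such that, almost surely, $|y^n[t]|\le y_{\max}$ and $|z^n_l[t]|\le z_{\max}$ in every slot of every frame, under every action, and $|d_l[t]|\le d_{\max}$, for all $n,l$; and there is $B\ge1$ such that $\mathbb E[(T^n_k-s)^2\mid\alpha^n_k=\alpha,\,T^n_k\ge s]\le B$ for all $n$, all $\alpha\in\mathcal A^n$ and all $s\in\{0,1,2,\dots\}$ with $\Pr(T^n_k\ge s\mid\alpha^n_k=\alpha)>0$. (c) (Compactness) for every $n$ the set $\big\{\big(\widehat y^n(\alpha)/\widehat T^n(\alpha),\ \widehat{\mathbf z}^n(\alpha)/\widehat T^n(\alpha)\big):\alpha\in\mathcal A^n\big\}$ is compact. Then, for each $n\in\{1,\dots,N\}$, there exists a pair $(\overline f^n_*,\overline{\mathbf g}^n_*)\in\mathcal P^n$ such that $$\sum_{n=1}^N\overline f^n_*=f_*,\qquad \sum_{n=1}^N\overline g^n_{l,*}\le d_l,\quad l\in\{1,\dots,L\}.$$ Furthermore, for any $(\overline f^n,\overline{\mathbf g}^n)\in\mathcal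 P^n$, $n\in\{1,\dots,N\}$, satisfying $\sum_{n=1}^N\overline g^n_l\le d_l$ for all $l\in\{1,\dots,L\}$, we have $\sum_{n=1}^N\overline f^n\ge f_*$. -/

import Mathlib

open MeasureTheory ProbabilityTheory Filter

namespace AsyncRenewal

universe u

/-- A possible outcome of one renewal frame: a positive integer duration `T`, and for every slot
`i = 0, …, T - 1` of the frame a penalty in `ℝ` and a vector of performance metrics in `ℝ^L`.
The per-slot values are padded by `0` at all `i ≥ T`, so an outcome is the same thing as a
nonempty finite sequence of pairs (penalty, metric vector). -/
abbrev FrameOutcome (L : ℕ) : Type :=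
  {x : ℕ × (ℕ → ℝ × (Fin L → ℝ)) // 0 < x.1 ∧ ∀ i, x.1 ≤ i → x.2 i = 0}

namespace FrameOutcome

variable {L : ℕ}

/-- The number of slots of the frame. -/
def duration (x : FrameOutcome L) : ℕ := x.1.1

/-- The penalty in the `i`-th slot of the frame. -/
def penalty (x : FrameOutcome L) (i : ℕ) : ℝ := (x.1.2 i).1

/-- The `l`-th performance metric in the `i`-th slot of the frame. -/
def metric (x : FrameOutcome L) (i : ℕ) (l : Fin L) : ℝ := (x.1.2 i).2 l

/-- The total penalty of the frame. -/
noncomputable def totalPenalty (x : FrameOutcome L) : ℝ :=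
  ∑ i ∈ Finset.range x.duration, x.penalty i

/-- The total of the `l`-th performance metric over the frame. -/
noncomputable def totalMetric (x : FrameOutcome L) (l : Fin L) : ℝ :=
  ∑ i ∈ Finset.range x.duration, x.metric i l

end FrameOutcome

/-- The data of `N` renewal systems with action sets `A n`, coupled by `L` constraints.
`frameLaw n a` is the law of a frame of system `n` in which the action `a` is used, and
`externalLaw` is the common law of the i.i.d. external vectors `d[t]`.
(The σ-algebra on `A n` only serves to speak of random actions.) -/
structure Problem (N L : ℕ) (A : Fin N → Type u) [∀ n, MeasurableSpace (A n)] where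
  frameLaw : (n : Fin N) → Kernel (A n) (FrameOutcome L)
  isMarkov : ∀ n, IsMarkovKernel (frameLaw n)
  externalLaw : Measure (Fin L → ℝ)
  isProb : IsProbabilityMeasure externalLaw

namespace Problem

variable {N L : ℕ} {A : Fin N → Type u} [∀ n, MeasurableSpace (A n)] (S : Problem N L A)

/-- `d_l`, the expectation of the `l`-th external variable. -/
noncomputable def dMean (l : Fin L) : ℝ := ∫ v, v l ∂S.externalLaw

/-! ### One-frame expectations and the performance region -/

/-- Expected total penalty of a frame under the action `a`. -/
noncomputable def yHat (n : Fin N) (a : A n) : ℝ := ∫ x, x.totalPenalty ∂(S.frameLaw n a)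

/-- Expected total of each performance metric over a frame under the action `a`. -/
noncomputable def zHat (n : Fin N) (a : A n) : Fin L → ℝ :=
  fun l => ∫ x, x.totalMetric l ∂(S.frameLaw n a)

/-- Expected duration of a frame under the action `a`. -/
noncomputable def THat (n : Fin N) (a : A n) : ℝ := ∫ x, (x.duration : ℝ) ∂(S.frameLaw n a)

/-- The performance vector of the action `a`. -/
noncomputable def perfVector (n : Fin N) (a : A n) : ℝ × (Fin L → ℝ) :=
  (S.yHat n a / S.THat n a, fun l => S.zHat n a l / S.THat n a)

/-- The convex hull of the triples of one-frame expectations of system `n`. -/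
noncomputable def frameHull (n : Fin N) : Set (ℝ × (Fin L → ℝ) × ℝ) :=
  convexHull ℝ (Set.range fun a : A n => (S.yHat n a, S.zHat n a, S.THat n a))

/-- The performance region of system `n`. -/
noncomputable def region (n : Fin N) : Set (ℝ × (Fin L → ℝ)) :=
  (fun s : ℝ × (Fin L → ℝ) × ℝ => (s.1 / s.2.2, fun l => s.2.1 l / s.2.2)) '' S.frameHull n

/-! ### The stochastic control problem -/

end Problem

/-- The outcome of the frame that occupies the slots `s, …, e - 1`, read off from a trajectory of
penalties and metrics. -/
noncomputable def observedFrame {L : ℕ} (s e : ℕ) (h : s < e) (y : ℕ → ℝ) (z : ℕ → Fin L → ℝ) :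
    FrameOutcome L :=
  ⟨(e - s, fun i => if i < e - s then (y (s + i), z (s + i)) else 0),
    Nat.sub_pos_of_lt h, fun _ hi => if_neg (not_lt.mpr hi)⟩

/-- The processes that result from operating the `N` systems by some (possibly randomized and
history-dependent) algorithm, on a probability space `(Ω, P)`.

`history t` is the information of all systems, and of the external process, from the slots
before `t`; as a frame is over at the end of its last slot, this includes whether `t` is a renewal
time. The action of a frame starting in slot `t` may depend on the information in `history t` and
on anything else (a randomization, for instance) that respects `renewal`. -/
structure Run {N L : ℕ} {A : Fin N → Type u} [∀ n, MeasurableSpace (A n)] (S : Problem N L A)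
    {Ω : Type u} [mΩ : MeasurableSpace Ω] (P : Measure Ω) where
  /-- `action n k` is the action of system `n` in its `k`-th frame -/
  action : (n : Fin N) → ℕ → Ω → A n
  /-- `renewalTime n k` is the first slot of the `k`-th frame of system `n` -/
  renewalTime : Fin N → ℕ → Ω → ℕ
  /-- the penalty of system `n` in slot `t` -/
  penalty : Fin N → ℕ → Ω → ℝ
  /-- the performance metrics of system `n` in slot `t` -/
  metric : Fin N → ℕ → Ω → Fin L → ℝ
  /-- the external process -/
  external : ℕ → Ω → Fin L → ℝ
  history : Filtration ℕ mΩ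
  renewalTime_zero : ∀ n ω, renewalTime n 0 ω = 0
  renewalTime_lt : ∀ n k ω, renewalTime n k ω < renewalTime n (k + 1) ω
  measurable_action : ∀ n k, Measurable (action n k)
  adapted_renewalTime : ∀ n k t, MeasurableSet[history t] {ω | renewalTime n k ω ≤ t}
  adapted_action : ∀ n k t (D : Set (A n)), MeasurableSet D →
    MeasurableSet[history t] {ω | renewalTime n k ω < t ∧ action n k ω ∈ D}
  adapted_penalty : ∀ n t, Measurable[history (t + 1)] (penalty n t)
  adapted_metric : ∀ n t, Measurable[history (t + 1)] (metric n t)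
  adapted_external : ∀ t, Measurable[history (t + 1)] (external t)
  /-- the external process is i.i.d.: `d[t]` has the prescribed law and is independent of the
  information from earlier slots, which contains `d[0], …, d[t-1]` -/
  external_law : ∀ t, P.map (external t) = S.externalLaw
  external_indep : ∀ t, Indep (MeasurableSpace.comap (external t) inferInstance) (history t) P
  /-- the renewal property: given the action `a` of the `k`-th frame of system `n` and given the
  information of all systems from the slots before its starting time, the frame has law
  `frameLaw n a`. -/
  renewal : ∀ (n : Fin N) (k t : ℕ) (H : Set Ω) (D : Set (A n)) (E : Set (FrameOutcome L)),
    MeasurableSet[history t] H → MeasurableSet D → MeasurableSet E →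
    P {ω | ω ∈ H ∧ renewalTime n k ω = t ∧ action n k ω ∈ D ∧
        observedFrame (renewalTime n k ω) (renewalTime n (k + 1) ω) (renewalTime_lt n k ω)
          (fun s => penalty n s ω) (fun s => metric n s ω) ∈ E}
      = ∫⁻ ω in {ω | ω ∈ H ∧ renewalTime n k ω = t ∧ action n k ω ∈ D},
          S.frameLaw n (action n k ω) E ∂P

namespace Run

variable {N L : ℕ} {A : Fin N → Type u} [∀ n, MeasurableSpace (A n)] {S : Problem N L A}
  {Ω : Type u} [MeasurableSpace Ω] {P : Measure Ω} (R : Run S P)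

/-- The time average penalty
`limsup_{T → ∞} (1/T) ∑_{t < T} ∑_n E[y^n[t]]`. -/
noncomputable def avgPenalty : ℝ :=
  limsup (fun T : ℕ => (1 / (T : ℝ)) *
    ∑ t ∈ Finset.range T, ∑ n, ∫ ω, R.penalty n t ω ∂P) atTop

/-- The time average of the `l`-th performance metric
`limsup_{T → ∞} (1/T) ∑_{t < T} ∑_n E[z^n_l[t]]`. -/
noncomputable def avgMetric (l : Fin L) : ℝ :=
  limsup (fun T : ℕ => (1 / (T : ℝ)) *
    ∑ t ∈ Finset.range T, ∑ n, ∫ ω, R.metric n t ω l ∂P) atTop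

end Run

namespace Problem

variable {N L : ℕ} {A : Fin N → Type u} [∀ n, MeasurableSpace (A n)] (S : Problem N L A)

/-- The objective values of all runs, on all probability spaces, that satisfy the constraints. -/
def feasibleValues : Set ℝ :=
  {v | ∃ (Ω : Type u) (_ : MeasurableSpace Ω) (P : Measure Ω) (_ : IsProbabilityMeasure P)
    (R : Run S P), (∀ l, R.avgMetric l ≤ S.dMean l) ∧ R.avgPenalty = v}

/-- The problem is feasible: some run satisfies the constraints. -/
def Feasible : Prop := S.feasibleValues.Nonempty

/-- The optimal value `f_*`: the infimum of the objective over all runs that satisfy the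
constraints. -/
noncomputable def optimalValue : ℝ := sInf S.feasibleValues

/-- The boundedness assumption: penalties, metrics and external variables are uniformly bounded,
and the residual lifetimes of all frames have uniformly bounded conditional second moments. -/
def Bounded : Prop :=
  (∃ yMax : ℝ, ∀ n a, ∀ᵐ x ∂(S.frameLaw n a), ∀ i < x.duration, |x.penalty i| ≤ yMax) ∧
  (∃ zMax : ℝ, ∀ n a, ∀ᵐ x ∂(S.frameLaw n a), ∀ i < x.duration, ∀ l, |x.metric i l| ≤ zMax) ∧
  (∃ dMax : ℝ, ∀ᵐ v ∂S.externalLaw, ∀ l, |v l| ≤ dMax) ∧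
  ∃ B : ℝ, 1 ≤ B ∧ ∀ n a (s : ℕ), 0 < S.frameLaw n a {x | s ≤ x.duration} →
    ∫⁻ x, ENNReal.ofReal (((x.duration : ℝ) - (s : ℝ)) ^ 2)
      ∂((S.frameLaw n a)[|{x | s ≤ x.duration}]) ≤ ENNReal.ofReal B

end Problem

end AsyncRenewal

open MeasureTheory ProbabilityTheory Filter

namespace AsyncRenewal

universe u

/-! The feasible values and the points of the performance regions that meet the constraints bound
each other, and compactness turns the infimum into a minimum.

From runs to points: fix a run and a horizon `T`. By the renewal property, the expected reward of
all frames starting before `T` is a sum of one-frame expectations. It differs from the expected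
reward collected before `T` only by what the frame active at `T` earns after `T`; the
residual-lifetime assumption bounds this uniformly in `T` (`Run.abs_frameSum_sub_sum_le`). Weighting
each action by its expected frame length, the expected penalties and metrics before `T` are thus `T`
times an average of performance vectors, up to a bounded error
(`Run.exists_mem_convexHull_perfVector`). The convex hulls of these vectors are compact, so one
subsequence of horizons works for all systems and coordinates, and its limit lies below every upper
limit that defines the time averages (`Run.exists_le_avg`).

From points to runs: a point of a region is the ratio of expected totals to expected duration under
some random action. Repeating that action independently in every frame gives a run on a product
space whose time averages converge to the chosen points (`Problem.exists_run_of_mem_region`). The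
delicate part is a filtration carrying the information of all systems, although their frames are not
synchronized (`Canonical.historyAlg`).

The hull of the performance vectors lies in the region (`ResidualBound.convexHull_subset_region`),
so a minimizer over the compact constrained product of hulls is itself attained by a run, and its
value is optimal. -/

/-! ### Compactness of convex hulls -/

/-- In a finite-dimensional space the convex hull of a compact set is compact. -/
theorem isCompact_convexHull_of_isCompact {E : Type*} [AddCommGroup E] [Module ℝ E]
    [TopologicalSpace E] [IsTopologicalAddGroup E] [ContinuousSMul ℝ E] [FiniteDimensional ℝ E]
    {s : Set E} (hs : IsCompact s) : IsCompact (convexHull ℝ s) := by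
  classical
  rcases s.eq_empty_or_nonempty with rfl | ⟨x₀, hx₀⟩
  · simp
  -- By Carathéodory, `m` points always suffice, so the hull is the continuous image of simplex
  -- weights times `m`-tuples of points of `s`.
  let m := Module.finrank ℝ E + 1
  let K : Set ((Fin m → ℝ) × (Fin m → E)) := stdSimplex ℝ (Fin m) ×ˢ Set.univ.pi fun _ => s
  let g : (Fin m → ℝ) × (Fin m → E) → E := fun q => ∑ i, q.1 i • q.2 i
  have hK : IsCompact K := (isCompact_stdSimplex ℝ (Fin m)).prod (isCompact_univ_pi fun _ => hs)
  have hg : Continuous g := by fun_prop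
  suffices convexHull ℝ s = g '' K by rw [this]; exact hK.image hg
  apply Set.Subset.antisymm
  · intro x hx
    obtain ⟨ι, _, z, w, hz, hind, hw, hw1, rfl⟩ := eq_pos_convex_span_of_mem_convexHull hx
    have hcard : Fintype.card ι ≤ Fintype.card (Fin m) := by
      rw [Fintype.card_fin]
      exact hind.card_le_finrank_succ.trans
        (Nat.add_le_add_right (Submodule.finrank_le _) 1)
    obtain ⟨e⟩ := Function.Embedding.nonempty_of_card_le hcard
    -- Fewer than `m` points are padded with weight `0` at the filler `x₀`.
    let w' : Fin m → ℝ := Function.extend e w 0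
    let z' : Fin m → E := Function.extend e z fun _ => x₀
    have hw'e : ∀ i, w' (e i) = w i := fun i => e.injective.extend_apply _ _ i
    have hz'e : ∀ i, z' (e i) = z i := fun i => e.injective.extend_apply _ _ i
    have hw'0 : ∀ j, j ∉ Set.range e → w' j = 0 := fun j hj =>
      Function.extend_apply' _ _ _ (by simpa using hj)
    have hz'0 : ∀ j, j ∉ Set.range e → z' j = x₀ := fun j hj =>
      Function.extend_apply' _ _ _ (by simpa using hj)
    refine ⟨(w', z'), ⟨⟨fun j => ?_, ?_⟩, fun j _ => ?_⟩, ?_⟩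
    · by_cases hj : j ∈ Set.range e
      · obtain ⟨i, rfl⟩ := hj
        simpa [hw'e] using (hw i).le
      · simp [hw'0 j hj]
    · simp only
      rw [← hw1]
      exact (Fintype.sum_of_injective e e.injective w w' hw'0 fun i => (hw'e i).symm).symm
    · by_cases hj : j ∈ Set.range e
      · obtain ⟨i, rfl⟩ := hj
        simpa [hz'e] using hz ⟨i, rfl⟩
      · simpa [hz'0 j hj] using hx₀
    · exact (Fintype.sum_of_injective e e.injective _ _
        (fun j hj => by simp only [hw'0 j hj, zero_smul]) fun i => by simp only [hw'e, hz'e]).symm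
  · rintro _ ⟨⟨w, z⟩, ⟨hw, hz⟩, rfl⟩
    exact (convex_convexHull ℝ s).sum_mem (fun i _ => hw.1 i) hw.2
      fun i _ => subset_convexHull ℝ s (hz i trivial)

/-! ### Frame outcomes -/

namespace FrameOutcome

variable {L : ℕ}

/-- The pair (penalty, metric vector) in the `i`-th slot of the frame. -/
def slot (x : FrameOutcome L) (i : ℕ) : ℝ × (Fin L → ℝ) := x.1.2 i

theorem duration_pos (x : FrameOutcome L) : 0 < x.duration := x.2.1

theorem slot_eq_zero (x : FrameOutcome L) {i : ℕ} (h : x.duration ≤ i) : x.slot i = 0 := x.2.2 i h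

@[ext]
theorem ext {x y : FrameOutcome L} (h : x.duration = y.duration)
    (h' : ∀ i < x.duration, x.slot i = y.slot i) : x = y := by
  refine Subtype.ext (Prod.ext h (funext fun i => ?_))
  by_cases hi : i < x.duration
  · exact h' i hi
  · exact (x.slot_eq_zero (not_lt.mp hi)).trans (y.slot_eq_zero (h ▸ not_lt.mp hi)).symm

@[fun_prop]
theorem measurable_duration : Measurable (duration : FrameOutcome L → ℕ) :=
  measurable_fst.comp measurable_subtype_coe

@[fun_prop]
theorem measurable_slot (i : ℕ) : Measurable fun x : FrameOutcome L => x.slot i :=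
  (measurable_pi_apply i).comp (measurable_snd.comp measurable_subtype_coe)

/-- The total over the frame of the reward `φ`, a function of the pair (penalty, metric vector)
of a slot. -/
noncomputable def total (φ : ℝ × (Fin L → ℝ) → ℝ) (x : FrameOutcome L) : ℝ :=
  ∑ i ∈ Finset.range x.duration, φ (x.slot i)

theorem measurable_total {φ : ℝ × (Fin L → ℝ) → ℝ} (hφ : Measurable φ) :
    Measurable (total φ) := by
  have h : Measurable fun p : ℕ × FrameOutcome L => ∑ i ∈ Finset.range p.1, φ (p.2.slot i) :=
    measurable_from_prod_countable_right fun T =>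
      Finset.measurable_sum (Finset.range T) fun i _ => hφ.comp (measurable_slot i)
  exact h.comp (measurable_duration.prodMk measurable_id)

theorem abs_total_le {φ : ℝ × (Fin L → ℝ) → ℝ} {C : ℝ} {x : FrameOutcome L}
    (h : ∀ i < x.duration, |φ (x.slot i)| ≤ C) : |total φ x| ≤ C * x.duration := by
  refine (Finset.abs_sum_le_sum_abs _ _).trans ?_
  refine (Finset.sum_le_sum fun i hi => h i (Finset.mem_range.mp hi)).trans ?_
  simp [mul_comm]

theorem total_one (x : FrameOutcome L) : total (fun _ => 1) x = x.duration := by simp [total]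

end FrameOutcome

/-! ### Expectations over a single frame -/

namespace Problem

variable {N L : ℕ} {A : Fin N → Type u} [∀ n, MeasurableSpace (A n)] (S : Problem N L A)

instance instIsMarkovKernelFrameLaw (n : Fin N) : IsMarkovKernel (S.frameLaw n) := S.isMarkov n

instance instIsProbabilityMeasureExternalLaw : IsProbabilityMeasure S.externalLaw := S.isProb

/-- The expected residual lifetime of a frame, on the event that the frame lasts at least `s`
slots, is at most `B` times the probability of that event. -/
def ResidualBound (B : ℝ) : Prop :=
  ∀ n a (s : ℕ), ∫⁻ x, ((x.duration - s : ℕ) : ENNReal) ∂(S.frameLaw n a) ≤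
    ENNReal.ofReal B * S.frameLaw n a {x | s ≤ x.duration}

/-- `C` is almost surely a bound for the reward `φ` in every slot of every frame. -/
def RewardBound (φ : ℝ × (Fin L → ℝ) → ℝ) (C : ℝ) : Prop :=
  ∀ n a, ∀ᵐ x ∂(S.frameLaw n a), ∀ i < x.duration, |φ (x.slot i)| ≤ C

theorem measurableSet_le_duration (s : ℕ) :
    MeasurableSet {x : FrameOutcome L | s ≤ x.duration} :=
  FrameOutcome.measurable_duration measurableSet_Ici

/-- A natural number is at most its square, so the conditional second moment dominates the first.
Off the event `s ≤ x.duration` the truncated subtraction is `0`. -/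
theorem residualBound_of_secondMoment {B : ℝ}
    (h : ∀ n a (s : ℕ), 0 < S.frameLaw n a {x | s ≤ x.duration} →
      ∫⁻ x, ENNReal.ofReal (((x.duration : ℝ) - (s : ℝ)) ^ 2)
        ∂((S.frameLaw n a)[|{x | s ≤ x.duration}]) ≤ ENNReal.ofReal B) :
    S.ResidualBound B := by
  intro n a s
  set D : Set (FrameOutcome L) := {x | s ≤ x.duration} with hD
  have hDm : MeasurableSet D := measurableSet_le_duration s
  have h1 : ∫⁻ x, ((x.duration - s : ℕ) : ENNReal) ∂(S.frameLaw n a) ≤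
      ∫⁻ x in D, ENNReal.ofReal (((x.duration : ℝ) - (s : ℝ)) ^ 2) ∂(S.frameLaw n a) := by
    rw [← lintegral_indicator hDm]
    refine lintegral_mono fun x => ?_
    by_cases hx : x ∈ D
    · rw [Set.indicator_of_mem hx]
      have hx' : s ≤ x.duration := hx
      rw [← ENNReal.ofReal_natCast, Nat.cast_sub hx', ← Nat.cast_sub hx']
      exact ENNReal.ofReal_le_ofReal (by exact_mod_cast Nat.le_self_pow two_ne_zero _)
    · rw [Set.indicator_of_notMem hx, nonpos_iff_eq_zero, Nat.sub_eq_zero_of_le (not_le.mp hx).le,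
        Nat.cast_zero]
  rcases eq_or_ne (S.frameLaw n a D) 0 with h0 | h0
  · rw [Measure.restrict_eq_zero.mpr h0] at h1
    simpa using h1.trans (by simp)
  · refine h1.trans ?_
    have h2 := h n a s (pos_iff_ne_zero.mpr h0)
    rw [ProbabilityTheory.cond, lintegral_smul_measure, smul_eq_mul] at h2
    rw [mul_comm, ← ENNReal.inv_mul_le_iff h0 (measure_ne_top _ _)]
    exact h2

/-- The expected total of the reward `φ` over a frame in which the action `a` is used. -/
noncomputable def totalHat (φ : ℝ × (Fin L → ℝ) → ℝ) (n : Fin N) (a : A n) : ℝ :=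
  ∫ x, x.total φ ∂(S.frameLaw n a)

theorem totalHat_one (n : Fin N) (a : A n) : S.totalHat (fun _ => 1) n a = S.THat n a := by
  simp only [totalHat, FrameOutcome.total_one, THat]

theorem rewardBound_one : S.RewardBound (fun _ => 1) 1 :=
  fun _ _ => Eventually.of_forall fun _ _ _ => by simp

theorem measurable_totalHat {φ : ℝ × (Fin L → ℝ) → ℝ} (hφ : Measurable φ) (n : Fin N) :
    Measurable (S.totalHat φ n) :=
  ((FrameOutcome.measurable_total hφ).stronglyMeasurable.integral_kernel
    (κ := S.frameLaw n)).measurable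

theorem measurable_THat (n : Fin N) : Measurable (S.THat n) :=
  funext (S.totalHat_one n) ▸ S.measurable_totalHat (φ := fun _ => 1) measurable_const n

theorem measurable_perfVector (n : Fin N) : Measurable (S.perfVector n) :=
  ((S.measurable_totalHat measurable_fst n).div (S.measurable_THat n)).prodMk
    (measurable_pi_lambda _ fun l =>
      (S.measurable_totalHat ((measurable_pi_apply l).comp measurable_snd) n).div
        (S.measurable_THat n))

variable {S}

theorem ResidualBound.lintegral_duration_le {B : ℝ} (hB : S.ResidualBound B) (n : Fin N)
    (a : A n) : ∫⁻ x, (x.duration : ENNReal) ∂(S.frameLaw n a) ≤ ENNReal.ofReal B := by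
  simpa using hB n a 0

theorem ResidualBound.integrable_duration {B : ℝ} (hB : S.ResidualBound B) (n : Fin N)
    (a : A n) : Integrable (fun x : FrameOutcome L => (x.duration : ℝ)) (S.frameLaw n a) := by
  have hm : Measurable fun x : FrameOutcome L => (x.duration : ℝ) := by fun_prop
  refine ⟨hm.aestronglyMeasurable, ?_⟩
  rw [hasFiniteIntegral_iff_ofReal (Eventually.of_forall fun x => Nat.cast_nonneg _)]
  simp only [ENNReal.ofReal_natCast]
  exact (hB.lintegral_duration_le n a).trans_lt ENNReal.ofReal_lt_top

theorem ResidualBound.one_le_THat {B : ℝ} (hB : S.ResidualBound B) (n : Fin N) (a : A n) :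
    1 ≤ S.THat n a := by
  have := integral_mono (μ := S.frameLaw n a) (integrable_const (1 : ℝ))
    (hB.integrable_duration n a) fun x => by
      simpa using (Nat.one_le_cast (α := ℝ)).mpr x.duration_pos
  simpa [THat] using this

theorem ResidualBound.THat_le {B : ℝ} (hB0 : 0 ≤ B) (hB : S.ResidualBound B) (n : Fin N)
    (a : A n) : S.THat n a ≤ B := by
  have hm : Measurable fun x : FrameOutcome L => (x.duration : ℝ) := by fun_prop
  rw [THat, integral_eq_lintegral_of_nonneg_ae (Eventually.of_forall fun x => Nat.cast_nonneg _)
    hm.aestronglyMeasurable]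
  simp only [ENNReal.ofReal_natCast]
  exact ENNReal.toReal_le_of_le_ofReal hB0 (hB.lintegral_duration_le n a)

theorem RewardBound.integrable_total {φ : ℝ × (Fin L → ℝ) → ℝ} {B C : ℝ} (hB : S.ResidualBound B)
    (hφ : Measurable φ) (hC : S.RewardBound φ C) (n : Fin N) (a : A n) :
    Integrable (FrameOutcome.total φ) (S.frameLaw n a) := by
  refine ((hB.integrable_duration n a).const_mul C).mono'
    (FrameOutcome.measurable_total hφ).aestronglyMeasurable ?_
  filter_upwards [hC n a] with x hx
  exact FrameOutcome.abs_total_le hx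

theorem RewardBound.abs_totalHat_le {φ : ℝ × (Fin L → ℝ) → ℝ} {B C : ℝ} (hB0 : 0 ≤ B)
    (hB : S.ResidualBound B) (hC0 : 0 ≤ C) (hC : S.RewardBound φ C) (n : Fin N) (a : A n) :
    |S.totalHat φ n a| ≤ C * B := by
  refine (norm_integral_le_of_norm_le (μ := S.frameLaw n a) (f := FrameOutcome.total φ)
    (g := fun x : FrameOutcome L => C * (x.duration : ℝ))
    ((hB.integrable_duration n a).const_mul C) ?_).trans ?_
  · filter_upwards [hC n a] with x hx
    exact FrameOutcome.abs_total_le hx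
  · rw [integral_const_mul]
    exact mul_le_mul_of_nonneg_left (hB.THat_le hB0 n a) hC0

theorem RewardBound.integrable_totalHat {φ : ℝ × (Fin L → ℝ) → ℝ} {B C : ℝ}
    (hC : S.RewardBound φ C) (hB0 : 0 ≤ B) (hB : S.ResidualBound B) (hφ : Measurable φ)
    (hC0 : 0 ≤ C) (n : Fin N) (μ : Measure (A n)) [IsFiniteMeasure μ] :
    Integrable (S.totalHat φ n) μ :=
  Integrable.of_bound (S.measurable_totalHat hφ n).aestronglyMeasurable (C * B)
    (Eventually.of_forall fun a => hC.abs_totalHat_le hB0 hB hC0 n a)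

/-- The performance region contains the convex hull of the performance vectors. -/
theorem ResidualBound.convexHull_subset_region {B : ℝ} (hB : S.ResidualBound B) (n : Fin N) :
    convexHull ℝ (Set.range (S.perfVector n)) ⊆ S.region n := by
  have hpos : ∀ s ∈ S.frameHull n, 0 < s.2.2 := by
    have : S.frameHull n ⊆ {s | 0 < s.2.2} := by
      refine convexHull_min ?_ ?_
      · rintro _ ⟨a, rfl⟩
        exact zero_lt_one.trans_le (hB.one_le_THat n a)
      · exact convex_halfSpace_gt (f := fun s : ℝ × (Fin L → ℝ) × ℝ => s.2.2)
          ⟨fun _ _ => rfl, fun _ _ => rfl⟩ 0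
    exact this
  refine convexHull_min ?_ ?_
  · rintro _ ⟨a, rfl⟩
    exact ⟨_, subset_convexHull ℝ _ ⟨a, rfl⟩, rfl⟩
  · rintro _ ⟨s, hs, rfl⟩ _ ⟨t, ht, rfl⟩ a b ha hb hab
    have hs0 := hpos s hs
    have ht0 := hpos t ht
    -- Division by the duration turns weights on triples into weights proportional to weight times
    -- duration. Mixing the triples with weights `a / s.2.2` and `b / t.2.2`, normalized by `c`,
    -- therefore produces the weights `a` and `b` on the ratios.
    set c : ℝ := a / s.2.2 + b / t.2.2 with hc
    have hc0 : 0 < c := by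
      rcases ha.lt_or_eq with ha' | ha'
      · have := div_pos ha' hs0
        have := div_nonneg hb ht0.le
        linarith
      · have hb' : 0 < b := by linarith
        have := div_nonneg ha hs0.le
        have := div_pos hb' ht0
        linarith
    have h1 : 0 ≤ a / s.2.2 / c := by positivity
    have h2 : 0 ≤ b / t.2.2 / c := by positivity
    have h3 : a / s.2.2 / c + b / t.2.2 / c = 1 := by
      rw [← add_div, ← hc, div_self hc0.ne']
    refine ⟨_, convex_convexHull ℝ _ hs ht h1 h2 h3, ?_⟩
    have hT : a / s.2.2 / c * s.2.2 + b / t.2.2 / c * t.2.2 = 1 / c := by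
      rw [div_right_comm, div_mul_cancel₀ _ hs0.ne', div_right_comm, div_mul_cancel₀ _ ht0.ne',
        ← add_div, hab]
    refine Prod.ext ?_ (funext fun l => ?_)
    · simp only [Prod.fst_add, Prod.smul_fst, Prod.snd_add, Prod.smul_snd, smul_eq_mul, hT]
      field_simp
    · simp only [Prod.fst_add, Prod.smul_fst, Prod.snd_add, Prod.smul_snd, smul_eq_mul, hT,
        Pi.add_apply, Pi.smul_apply]
      field_simp

end Problem

/-! ### Sums over the frames of one trajectory -/

/-- Splitting a sum over the slots before `T` into the contributions of the frames. -/
theorem sum_range_eq_sum_frames {τ : ℕ → ℕ} (h0 : τ 0 = 0) (hτ : StrictMono τ) (u : ℕ → ℝ)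
    (T : ℕ) : ∑ t ∈ Finset.range T, u t =
      ∑ k ∈ Finset.range T, ∑ t ∈ Finset.Ico (min (τ k) T) (min (τ (k + 1)) T), u t := by
  have h : ∀ M, ∑ k ∈ Finset.range M, ∑ t ∈ Finset.Ico (min (τ k) T) (min (τ (k + 1)) T), u t =
      ∑ t ∈ Finset.range (min (τ M) T), u t := by
    intro M
    induction M with
    | zero => simp [h0]
    | succ M ih =>
      rw [Finset.sum_range_succ, ih, Finset.range_eq_Ico, Finset.range_eq_Ico,
        Finset.sum_Ico_consecutive _ (Nat.zero_le _)
          (min_le_min_right T (hτ.monotone (Nat.le_succ M)))]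
  -- Frames have length at least one, so the first `T` frames cover all slots before `T`.
  rw [h, min_eq_right (show T ≤ τ T from hτ.id_le T)]

/-- The rewards collected in all frames that start before `T` differ from the rewards collected
before `T` by at most the rewards collected after `T` in the frame that is active at `T`. -/
theorem abs_sum_frames_sub_sum_range_le {τ : ℕ → ℕ} (h0 : τ 0 = 0) (hτ : StrictMono τ)
    {u : ℕ → ℝ} {C : ℝ} (hu : ∀ t, |u t| ≤ C) (T : ℕ) :
    |(∑ k ∈ Finset.range T,
        if τ k < T then ∑ i ∈ Finset.range (τ (k + 1) - τ k), u (τ k + i) else 0) -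
      ∑ t ∈ Finset.range T, u t| ≤
    C * ∑ k ∈ Finset.range T, (if τ k < T then ((τ (k + 1) - T : ℕ) : ℝ) else 0) := by
  rw [sum_range_eq_sum_frames h0 hτ u T, ← Finset.sum_sub_distrib _ _, Finset.mul_sum]
  refine (Finset.abs_sum_le_sum_abs _ _).trans (Finset.sum_le_sum fun k _ => ?_)
  have hk : τ k < τ (k + 1) := hτ (Nat.lt_succ_self k)
  split_ifs with h
  -- A frame starting before `T` leaves in the difference only its slots from `T` on.
  · rw [← Finset.sum_Ico_eq_sum_range, min_eq_left h.le,
      ← Finset.sum_Ico_consecutive u (le_min hk.le h.le) (min_le_left _ T), add_sub_cancel_left]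
    refine (Finset.abs_sum_le_sum_abs _ _).trans ((Finset.sum_le_sum fun t _ => hu t).trans ?_)
    rw [Finset.sum_const, Nat.card_Ico, nsmul_eq_mul, mul_comm]
    refine mul_le_mul_of_nonneg_left ?_ ((abs_nonneg _).trans (hu 0))
    exact_mod_cast (by omega : τ (k + 1) - min (τ (k + 1)) T ≤ τ (k + 1) - T)
  · have : min (τ k) T = min (τ (k + 1)) T := by omega
    simp [this]

/-- Every slot belongs to a frame. -/
theorem exists_frame_of_slot {τ : ℕ → ℕ} (h0 : τ 0 = 0) (hτ : StrictMono τ) (t : ℕ) :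
    ∃ k, τ k ≤ t ∧ t < τ (k + 1) := by
  induction t with
  | zero => exact ⟨0, h0.le, by rw [← h0]; exact hτ (by rw [h0]; exact zero_lt_one)⟩
  | succ t ih =>
    obtain ⟨k, h1, h2⟩ := ih
    by_cases h : t + 1 < τ (k + 1)
    · exact ⟨k, by omega, h⟩
    · exact ⟨k + 1, by omega, lt_of_le_of_lt (Nat.succ_le_of_lt h2) (hτ (Nat.lt_succ_self (k + 1)))⟩

/-! ### Frames of a run -/

namespace Run

variable {N L : ℕ} {A : Fin N → Type u} [∀ n, MeasurableSpace (A n)] {S : Problem N L A}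
  {Ω : Type u} [mΩ : MeasurableSpace Ω] {P : Measure Ω} (R : Run S P)

/-- The pair (penalty, metric vector) of system `n` in slot `t`. -/
def slot (n : Fin N) (t : ℕ) (ω : Ω) : ℝ × (Fin L → ℝ) := (R.penalty n t ω, R.metric n t ω)

/-- The `k`-th frame of system `n`. -/
noncomputable def frame (n : Fin N) (k : ℕ) (ω : Ω) : FrameOutcome L :=
  observedFrame (R.renewalTime n k ω) (R.renewalTime n (k + 1) ω) (R.renewalTime_lt n k ω)
    (fun s => R.penalty n s ω) (fun s => R.metric n s ω)

theorem strictMono_renewalTime (n : Fin N) (ω : Ω) : StrictMono fun k => R.renewalTime n k ω :=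
  strictMono_nat_of_lt_succ fun k => R.renewalTime_lt n k ω

theorem duration_frame (n : Fin N) (k : ℕ) (ω : Ω) :
    (R.frame n k ω).duration = R.renewalTime n (k + 1) ω - R.renewalTime n k ω := rfl

theorem slot_frame (n : Fin N) (k : ℕ) (ω : Ω) {i : ℕ} (hi : i < (R.frame n k ω).duration) :
    (R.frame n k ω).slot i = R.slot n (R.renewalTime n k ω + i) ω := if_pos hi

theorem total_frame (φ : ℝ × (Fin L → ℝ) → ℝ) (n : Fin N) (k : ℕ) (ω : Ω) :
    (R.frame n k ω).total φ =
      ∑ i ∈ Finset.range (R.renewalTime n (k + 1) ω - R.renewalTime n k ω),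
        φ (R.slot n (R.renewalTime n k ω + i) ω) :=
  Finset.sum_congr rfl fun i hi => by rw [slot_frame]; exact Finset.mem_range.mp hi

@[fun_prop]
theorem measurable_renewalTime (n : Fin N) (k : ℕ) : Measurable (R.renewalTime n k) :=
  measurable_of_Iic fun t => R.history.le t _ (R.adapted_renewalTime n k t)

@[fun_prop]
theorem measurable_slot (n : Fin N) (t : ℕ) : Measurable (R.slot n t) :=
  ((R.adapted_penalty n t).mono (R.history.le _) le_rfl).prodMk
    ((R.adapted_metric n t).mono (R.history.le _) le_rfl)

@[fun_prop]
theorem measurable_frame (n : Fin N) (k : ℕ) : Measurable (R.frame n k) := by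
  refine Measurable.subtype_mk (Measurable.prodMk ?_ (measurable_pi_lambda _ fun i => ?_))
  · exact (R.measurable_renewalTime n (k + 1)).sub (R.measurable_renewalTime n k)
  · refine Measurable.ite ?_ ?_ measurable_const
    · exact measurableSet_lt measurable_const
        ((R.measurable_renewalTime n (k + 1)).sub (R.measurable_renewalTime n k))
    · have h : Measurable fun p : ℕ × Ω => R.slot n (p.1 + i) p.2 :=
        measurable_from_prod_countable_right fun s => R.measurable_slot n (s + i)
      exact h.comp ((R.measurable_renewalTime n k).prodMk measurable_id)

theorem measurableSet_renewalTime_mem (n : Fin N) (k : ℕ) (V : Set ℕ) :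
    MeasurableSet {ω | R.renewalTime n k ω ∈ V} :=
  R.measurable_renewalTime n k (MeasurableSet.of_discrete (s := V))

/-- The renewal property as an identity of measures: on the event that the `k`-th frame of system
`n` starts in a slot of `V`, this frame is distributed according to `frameLaw`. -/
theorem map_frame (n : Fin N) (k : ℕ) (V : Set ℕ) :
    (P.restrict {ω | R.renewalTime n k ω ∈ V}).map (R.frame n k) =
      S.frameLaw n ∘ₘ (P.restrict {ω | R.renewalTime n k ω ∈ V}).map (R.action n k) := by
  ext E hE
  rw [Measure.bind_apply hE (Kernel.aemeasurable _), lintegral_map (Kernel.measurable_coe _ hE)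
    (R.measurable_action n k), Measure.map_apply (R.measurable_frame n k) hE,
    Measure.restrict_apply (R.measurable_frame n k hE)]
  -- The renewal property speaks of a fixed starting slot; the countably many slots of `V` are
  -- treated separately and summed.
  have hV : {ω | R.renewalTime n k ω ∈ V} = ⋃ t ∈ V, {ω | R.renewalTime n k ω = t} := by
    ext ω; simp
  have hm : ∀ t ∈ V, MeasurableSet {ω | R.renewalTime n k ω = t} := fun t _ =>
    R.measurableSet_renewalTime_mem n k {t}
  have hd : V.PairwiseDisjoint fun t => {ω | R.renewalTime n k ω = t} := by
    intro s _ t _ hst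
    refine Set.disjoint_left.mpr fun ω (hs : _ = s) (ht : _ = t) => hst (hs ▸ ht)
  rw [hV, lintegral_biUnion V.to_countable hm hd, Set.inter_iUnion₂,
    measure_biUnion V.to_countable
      (fun s hs t ht hst => (hd hs ht hst).mono Set.inter_subset_right Set.inter_subset_right)
      fun t ht => (R.measurable_frame n k hE).inter (hm t ht)]
  refine tsum_congr fun t => ?_
  have h := R.renewal n k t Set.univ Set.univ E MeasurableSet.univ MeasurableSet.univ hE
  simp only [Set.mem_univ, true_and, and_true] at h
  refine Eq.trans (congrArg P ?_) h
  ext ω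
  exact and_comm

/-- The event that the `k`-th frame of system `n` starts before slot `T`. -/
def startsBefore (n : Fin N) (k T : ℕ) : Set Ω := {ω | R.renewalTime n k ω < T}

theorem measurableSet_startsBefore (n : Fin N) (k T : ℕ) :
    MeasurableSet (R.startsBefore n k T) := R.measurableSet_renewalTime_mem n k (Set.Iio T)

variable {B C : ℝ} {φ : ℝ × (Fin L → ℝ) → ℝ}

/-- The bound is given under the frame laws. `map_frame` carries it to every frame of the run, and
every slot lies in some frame. -/
theorem ae_forall_slot_le [IsProbabilityMeasure P] (hφ : Measurable φ) (hC : S.RewardBound φ C)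
    (n : Fin N) :
    ∀ᵐ ω ∂P, ∀ t, |φ (R.slot n t ω)| ≤ C := by
  have hm : MeasurableSet {x : FrameOutcome L | ∀ i < x.duration, |φ (x.slot i)| ≤ C} := by
    have h1 : {x : FrameOutcome L | ∀ i < x.duration, |φ (x.slot i)| ≤ C} =
        ⋂ i, ({x | x.duration ≤ i} ∪ {x | |φ (x.slot i)| ≤ C}) := by
      ext x
      simp only [Set.mem_iInter]
      exact forall_congr' fun i => by
        rw [imp_iff_not_or, not_lt]; rfl
    rw [h1]
    refine MeasurableSet.iInter fun i => MeasurableSet.union ?_ ?_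
    · exact FrameOutcome.measurable_duration (measurableSet_Iic (a := i))
    · exact measurableSet_le (hφ.comp (FrameOutcome.measurable_slot i)).abs measurable_const
  have h : ∀ᵐ ω ∂P, ∀ k, ∀ i < (R.frame n k ω).duration, |φ ((R.frame n k ω).slot i)| ≤ C := by
    refine ae_all_iff.mpr fun k => ?_
    have h1 := R.map_frame n k Set.univ
    simp only [Set.mem_univ, Set.ofPred_true, Measure.restrict_univ] at h1
    refine ae_of_ae_map (R.measurable_frame n k).aemeasurable
      (p := fun x => ∀ i < x.duration, |φ (x.slot i)| ≤ C) ?_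
    rw [h1]
    exact Measure.ae_comp_of_ae_ae hm (Eventually.of_forall fun a => hC n a)
  filter_upwards [h] with ω hω t
  obtain ⟨k, h1, h2⟩ := exists_frame_of_slot (R.renewalTime_zero n ω)
    (R.strictMono_renewalTime n ω) t
  have h3 : t - R.renewalTime n k ω < (R.frame n k ω).duration := by
    rw [duration_frame]; omega
  have h4 := hω k _ h3
  rwa [slot_frame _ _ _ _ h3, Nat.add_sub_cancel' h1] at h4

theorem integrable_slot [IsProbabilityMeasure P] (hφ : Measurable φ) (hC : S.RewardBound φ C)
    (n : Fin N) (t : ℕ) : Integrable (fun ω => φ (R.slot n t ω)) P := by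
  refine Integrable.of_bound (hφ.comp (R.measurable_slot n t)).aestronglyMeasurable C ?_
  filter_upwards [R.ae_forall_slot_le hφ hC n] with ω hω using hω t

theorem abs_integral_slot_le [IsProbabilityMeasure P] (hφ : Measurable φ)
    (hC : S.RewardBound φ C) (n : Fin N) (t : ℕ) : |∫ ω, φ (R.slot n t ω) ∂P| ≤ C := by
  have := norm_integral_le_of_norm_le_const (μ := P) (f := fun ω => φ (R.slot n t ω)) (C := C)
    (by filter_upwards [R.ae_forall_slot_le hφ hC n] with ω hω using hω t)
  simpa using this

theorem lintegral_frame {F : FrameOutcome L → ENNReal} (hF : Measurable F) (n : Fin N) (k : ℕ)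
    (V : Set ℕ) : ∫⁻ ω in {ω | R.renewalTime n k ω ∈ V}, F (R.frame n k ω) ∂P =
      ∫⁻ ω in {ω | R.renewalTime n k ω ∈ V}, ∫⁻ x, F x ∂(S.frameLaw n (R.action n k ω)) ∂P := by
  rw [← lintegral_map hF (R.measurable_frame n k), map_frame,
    Measure.lintegral_bind (Kernel.aemeasurable _) hF.aemeasurable,
    lintegral_map hF.lintegral_kernel (R.measurable_action n k)]

theorem integral_frame {F : FrameOutcome L → ℝ} (hF : Measurable F) {n : Fin N} {k : ℕ}
    (hi : Integrable (fun ω => F (R.frame n k ω)) P) (V : Set ℕ) :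
    ∫ ω in {ω | R.renewalTime n k ω ∈ V}, F (R.frame n k ω) ∂P =
      ∫ ω in {ω | R.renewalTime n k ω ∈ V}, ∫ x, F x ∂(S.frameLaw n (R.action n k ω)) ∂P := by
  have h1 : Integrable F ((P.restrict {ω | R.renewalTime n k ω ∈ V}).map (R.frame n k)) :=
    (integrable_map_measure hF.aestronglyMeasurable (R.measurable_frame n k).aemeasurable).mpr
      hi.restrict
  rw [← integral_map (R.measurable_frame n k).aemeasurable hF.aestronglyMeasurable]
  rw [map_frame, Measure.comp_eq_comp_const_apply] at h1 ⊢
  rw [Kernel.integral_comp h1, Kernel.const_apply,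
    integral_map (R.measurable_action n k).aemeasurable
      (hF.stronglyMeasurable.integral_kernel (κ := S.frameLaw n)).aestronglyMeasurable]

theorem integrable_duration [IsProbabilityMeasure P] (hB : S.ResidualBound B) (n : Fin N) (k : ℕ) :
    Integrable (fun ω => ((R.frame n k ω).duration : ℝ)) P := by
  have hm : Measurable fun x : FrameOutcome L => (x.duration : ENNReal) := by fun_prop
  have hm' : Measurable fun ω => ((R.frame n k ω).duration : ℝ) := by fun_prop
  refine ⟨hm'.aestronglyMeasurable, ?_⟩
  rw [hasFiniteIntegral_iff_ofReal (Eventually.of_forall fun x => Nat.cast_nonneg _)]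
  simp only [ENNReal.ofReal_natCast]
  have h := R.lintegral_frame hm n k Set.univ
  simp only [Set.mem_univ, Set.ofPred_true, Measure.restrict_univ] at h
  rw [h]
  refine (lintegral_mono fun ω => hB.lintegral_duration_le n (R.action n k ω)).trans_lt ?_
  simp

theorem integrable_total [IsProbabilityMeasure P] (hB : S.ResidualBound B)
    (hφ : Measurable φ) (hC : S.RewardBound φ C) (n : Fin N) (k : ℕ) :
    Integrable (fun ω => (R.frame n k ω).total φ) P := by
  refine ((R.integrable_duration hB n k).const_mul C).mono'
    ((FrameOutcome.measurable_total hφ).comp (R.measurable_frame n k)).aestronglyMeasurable ?_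
  filter_upwards [R.ae_forall_slot_le hφ hC n] with ω hω
  exact FrameOutcome.abs_total_le fun i hi => by rw [slot_frame _ _ _ _ hi]; exact hω _

/-- If the frame starts in slot `t < T`, its part beyond `T` is its residual lifetime at age `T -
t`, to which `ResidualBound` applies. The probability that the frame reaches `T` is kept on the
right: these probabilities sum to at most `1` over `k`, which makes the total overshoot bounded
independently of `T`. -/
theorem lintegral_residual_le (hB : S.ResidualBound B) (n : Fin N) (k T : ℕ) :
    ∫⁻ ω in R.startsBefore n k T, ((R.renewalTime n (k + 1) ω - T : ℕ) : ENNReal) ∂P ≤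
      ENNReal.ofReal B * P (R.startsBefore n k T \ R.startsBefore n (k + 1) T) := by
  have hU : R.startsBefore n k T = ⋃ t ∈ Finset.range T,
      {ω | R.renewalTime n k ω ∈ ({t} : Set ℕ)} := by
    ext ω; simp [startsBefore]
  have hm : ∀ t ∈ Finset.range T, MeasurableSet {ω | R.renewalTime n k ω ∈ ({t} : Set ℕ)} :=
    fun t _ => R.measurableSet_renewalTime_mem n k {t}
  have hd : Set.PairwiseDisjoint (↑(Finset.range T))
      fun t => {ω | R.renewalTime n k ω ∈ ({t} : Set ℕ)} := by
    intro s _ t _ hst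
    exact Set.disjoint_left.mpr fun ω (hs : _ = s) (ht : _ = t) => hst (hs ▸ ht)
  have hslot : ∀ t < T, ∫⁻ ω in {ω | R.renewalTime n k ω ∈ ({t} : Set ℕ)},
      ((R.renewalTime n (k + 1) ω - T : ℕ) : ENNReal) ∂P ≤ ENNReal.ofReal B *
        P ({ω | R.renewalTime n k ω ∈ ({t} : Set ℕ)} \ R.startsBefore n (k + 1) T) := by
    intro t ht
    have hV := R.measurableSet_renewalTime_mem n k {t}
    let D : Set (FrameOutcome L) := {x | T - t ≤ x.duration}
    have hD : MeasurableSet D := Problem.measurableSet_le_duration _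
    have h1 := R.lintegral_frame (P := P)
      (F := fun x => ((x.duration - (T - t) : ℕ) : ENNReal)) (by fun_prop) n k {t}
    have h2 := R.lintegral_frame (P := P) (F := D.indicator 1)
      (measurable_one.indicator hD) n k {t}
    simp only [lintegral_indicator_one hD] at h2
    have h3 : ∫⁻ ω in {ω | R.renewalTime n k ω ∈ ({t} : Set ℕ)},
        D.indicator 1 (R.frame n k ω) ∂P =
        P ({ω | R.renewalTime n k ω ∈ ({t} : Set ℕ)} \ R.startsBefore n (k + 1) T) := by
      have : ∀ ω, D.indicator (1 : FrameOutcome L → ENNReal) (R.frame n k ω) =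
          (R.frame n k ⁻¹' D).indicator 1 ω := fun ω => rfl
      simp only [this]
      rw [lintegral_indicator_one (R.measurable_frame n k hD),
        Measure.restrict_apply (R.measurable_frame n k hD)]
      congr 1
      ext ω
      have hlt := R.renewalTime_lt n k ω
      have e1 : ω ∈ R.frame n k ⁻¹' D ↔
          T - t ≤ R.renewalTime n (k + 1) ω - R.renewalTime n k ω := Iff.rfl
      have e2 : ω ∈ {ω | R.renewalTime n k ω ∈ ({t} : Set ℕ)} ↔ R.renewalTime n k ω = t := Iff.rfl
      have e3 : ω ∈ R.startsBefore n (k + 1) T ↔ R.renewalTime n (k + 1) ω < T := Iff.rfl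
      rw [Set.mem_inter_iff, Set.mem_sdiff, e1, e2, e3]
      omega
    rw [← h3, h2, ← lintegral_const_mul _ (f := fun ω => S.frameLaw n (R.action n k ω) D)
      ((Kernel.measurable_coe _ hD).comp (R.measurable_action n k))]
    refine le_trans (le_of_eq ?_) (h1.le.trans (lintegral_mono fun ω => hB n _ (T - t)))
    refine setLIntegral_congr_fun hV fun ω (hω : _ = t) => ?_
    have hlt := R.renewalTime_lt n k ω
    simp only [duration_frame]
    congr 1
    omega
  have hU' : R.startsBefore n k T \ R.startsBefore n (k + 1) T = ⋃ t ∈ Finset.range T,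
      ({ω | R.renewalTime n k ω ∈ ({t} : Set ℕ)} \ R.startsBefore n (k + 1) T) := by
    simp only [hU, Set.iUnion_sdiff]
  rw [hU', measure_biUnion_finset
      (fun s hs t ht hst => (hd hs ht hst).mono Set.sdiff_subset Set.sdiff_subset)
      (fun t ht => (hm t ht).diff (R.measurableSet_startsBefore n (k + 1) T)),
    hU, lintegral_biUnion_finset hd hm, Finset.mul_sum]
  exact Finset.sum_le_sum fun t ht => hslot t (Finset.mem_range.mp ht)

/-- At most one `k` satisfies "start before `T`, next start not before `T`", so the events are
disjoint. -/
theorem sum_measure_startsBefore_diff_le [IsProbabilityMeasure P] (n : Fin N) (T : ℕ)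
    (s : Finset ℕ) :
    ∑ k ∈ s, P (R.startsBefore n k T \ R.startsBefore n (k + 1) T) ≤ 1 := by
  rw [← measure_biUnion_finset]
  · exact prob_le_one
  · intro i _ j _ hij
    refine Set.disjoint_left.mpr fun ω hi hj => hij ?_
    obtain ⟨hi1, hi2⟩ := hi
    obtain ⟨hj1, hj2⟩ := hj
    have hmono := (R.strictMono_renewalTime n ω).monotone
    simp only [startsBefore, Set.mem_ofPred_eq, not_lt] at hi1 hi2 hj1 hj2
    by_contra hne
    rcases Nat.lt_or_gt_of_ne hne with h | h
    · exact absurd (hmono (Nat.succ_le_of_lt h)) (not_le.mpr (hj1.trans_le hi2))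
    · exact absurd (hmono (Nat.succ_le_of_lt h)) (not_le.mpr (hi1.trans_le hj2))
  · exact fun k _ => (R.measurableSet_startsBefore n k T).diff (R.measurableSet_startsBefore n _ T)

/-- The expected total of the reward `φ` over the frames of system `n` that start before `T`,
computed from the one-frame expectations. -/
noncomputable def frameSum (φ : ℝ × (Fin L → ℝ) → ℝ) (n : Fin N) (T : ℕ) : ℝ :=
  ∑ k ∈ Finset.range T, ∫ ω in R.startsBefore n k T, S.totalHat φ n (R.action n k ω) ∂P

/-- The expected reward before `T` is approximated by `frameSum`, uniformly in `T`. -/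
theorem abs_frameSum_sub_sum_le [IsProbabilityMeasure P] (hB0 : 0 ≤ B) (hB : S.ResidualBound B)
    (hφ : Measurable φ) (hC0 : 0 ≤ C) (hC : S.RewardBound φ C) (n : Fin N) (T : ℕ) :
    |R.frameSum φ n T - ∑ t ∈ Finset.range T, ∫ ω, φ (R.slot n t ω) ∂P| ≤ C * B := by
  classical
  -- The overshoot of the `k`-th frame beyond `T`.
  let res : ℕ → Ω → ℝ := fun k =>
    (R.startsBefore n k T).indicator fun ω => ((R.renewalTime n (k + 1) ω - T : ℕ) : ℝ)
  have hres0 : ∀ k ω, 0 ≤ res k ω := fun k ω =>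
    Set.indicator_nonneg (fun _ _ => Nat.cast_nonneg _) _
  have hresm : ∀ k, Measurable (res k) := fun k =>
    Measurable.indicator (by fun_prop) (R.measurableSet_startsBefore n k T)
  have hreslint : ∀ k, ∫⁻ ω, ENNReal.ofReal (res k ω) ∂P ≤
      ENNReal.ofReal B * P (R.startsBefore n k T \ R.startsBefore n (k + 1) T) := by
    intro k
    refine le_trans (le_of_eq ?_) (R.lintegral_residual_le hB n k T)
    rw [← lintegral_indicator (R.measurableSet_startsBefore n k T)]
    refine lintegral_congr fun ω => ?_
    by_cases h : ω ∈ R.startsBefore n k T <;> simp [res, h]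
  have hresi : ∀ k, Integrable (res k) P := by
    intro k
    refine ⟨(hresm k).aestronglyMeasurable, ?_⟩
    rw [hasFiniteIntegral_iff_ofReal (Eventually.of_forall (hres0 k))]
    exact (hreslint k).trans_lt (ENNReal.mul_lt_top ENNReal.ofReal_lt_top (measure_lt_top _ _))
  have hsum : ∫ ω, ∑ k ∈ Finset.range T, res k ω ∂P ≤ B := by
    rw [integral_eq_lintegral_of_nonneg_ae
      (Eventually.of_forall fun ω => Finset.sum_nonneg fun k _ => hres0 k ω)
      (Finset.measurable_sum (Finset.range T) fun k _ => hresm k).aestronglyMeasurable]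
    refine ENNReal.toReal_le_of_le_ofReal hB0 ?_
    simp only [ENNReal.ofReal_sum_of_nonneg fun k _ => hres0 k _]
    rw [lintegral_finsetSum _ fun k _ => (hresm k).ennreal_ofReal]
    refine (Finset.sum_le_sum fun k _ => hreslint k).trans ?_
    rw [← Finset.mul_sum]
    exact mul_le_of_le_one_right' (R.sum_measure_startsBefore_diff_le n T _)
  -- Whether a frame starts before `T` is a condition on its starting slot alone, so the renewal
  -- property replaces the one-frame expectation by the actual total of the frame.
  have htot : R.frameSum φ n T = ∫ ω, ∑ k ∈ Finset.range T,
      (R.startsBefore n k T).indicator (fun ω => (R.frame n k ω).total φ) ω ∂P := by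
    rw [integral_finsetSum _ fun k _ =>
      (R.integrable_total hB hφ hC n k).indicator (R.measurableSet_startsBefore n k T)]
    refine Finset.sum_congr rfl fun k _ => ?_
    rw [integral_indicator (R.measurableSet_startsBefore n k T)]
    exact (R.integral_frame (FrameOutcome.measurable_total hφ)
      (R.integrable_total hB hφ hC n k) (Set.Iio T)).symm
  rw [htot, ← integral_finsetSum _ fun t _ => R.integrable_slot hφ hC n t, ← integral_sub
    (integrable_finsetSum _ fun k _ =>
      (R.integrable_total hB hφ hC n k).indicator (R.measurableSet_startsBefore n k T))
    (integrable_finsetSum _ fun t _ => R.integrable_slot hφ hC n t)]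
  have hg := (integrable_finsetSum (Finset.range T) fun k _ => hresi k).const_mul C
  rw [← Real.norm_eq_abs]
  refine (norm_integral_le_of_norm_le hg ?_).trans ?_
  · filter_upwards [R.ae_forall_slot_le hφ hC n] with ω hω
    have h := abs_sum_frames_sub_sum_range_le (R.renewalTime_zero n ω)
      (R.strictMono_renewalTime n ω) hω T
    simpa only [Real.norm_eq_abs, Set.indicator_apply, total_frame, res, startsBefore,
      Set.mem_ofPred_eq] using h
  · rw [integral_const_mul]
    exact mul_le_mul_of_nonneg_left hsum hC0

end Run

/-! ### Time averages and the performance region -/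

/-- A limit point of a bounded real sequence is at most its upper limit. -/
theorem le_limsup_of_tendsto_subseq {v : ℕ → ℝ} {M a : ℝ} (hv : ∀ T, |v T| ≤ M) {ψ : ℕ → ℕ}
    (hψ : Tendsto ψ atTop atTop) (h : Tendsto (v ∘ ψ) atTop (nhds a)) : a ≤ limsup v atTop := by
  have h1 : IsBoundedUnder (· ≤ ·) atTop v :=
    isBoundedUnder_of ⟨M, fun T => (abs_le.mp (hv T)).2⟩
  have h2 : IsBoundedUnder (· ≥ ·) (map ψ atTop) v :=
    isBoundedUnder_of ⟨-M, fun T => (abs_le.mp (hv T)).1⟩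
  rw [← h.limsup_eq, limsup_comp]
  exact limsup_le_limsup_of_le hψ h2.isCoboundedUnder_le h1

/-- If the `n`-th family of expectations is, up to a bounded error, `T` times `q T n`, then the
time averages of the sums over `n` converge along every subsequence along which `q` does. -/
theorem tendsto_average_of_abs_sub_le {N : ℕ} {e : ℕ → Fin N → ℝ} {q : ℕ → Fin N → ℝ}
    {K : ℝ} {p : Fin N → ℝ} {ψ : ℕ → ℕ} (hψ : Tendsto ψ atTop atTop) (hψ0 : ∀ j, 0 < ψ j)
    (hq : ∀ j n, |∑ t ∈ Finset.range (ψ j), e t n - ψ j * q j n| ≤ K)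
    (hp : ∀ n, Tendsto (fun j => q j n) atTop (nhds (p n))) :
    Tendsto ((fun T : ℕ => (1 / (T : ℝ)) * ∑ t ∈ Finset.range T, ∑ n, e t n) ∘ ψ) atTop
      (nhds (∑ n, p n)) := by
  have h : ∀ n, Tendsto (fun j => (1 / (ψ j : ℝ)) * ∑ t ∈ Finset.range (ψ j), e t n) atTop
      (nhds (p n)) := by
    intro n
    have h0 : Tendsto (fun j => K / (ψ j : ℝ)) atTop (nhds 0) :=
      (tendsto_const_div_atTop_nhds_zero_nat K).comp hψ
    have h1 : Tendsto (fun j => (1 / (ψ j : ℝ)) * ∑ t ∈ Finset.range (ψ j), e t n - q j n) atTop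
        (nhds 0) := by
      refine squeeze_zero_norm (fun j => ?_) h0
      have hpos : (0 : ℝ) < ψ j := by exact_mod_cast hψ0 j
      have : (1 / (ψ j : ℝ)) * ∑ t ∈ Finset.range (ψ j), e t n - q j n =
          (∑ t ∈ Finset.range (ψ j), e t n - ψ j * q j n) / ψ j := by field_simp
      rw [this, Real.norm_eq_abs, abs_div, abs_of_pos hpos]
      exact div_le_div_of_nonneg_right (hq j n) hpos.le
    simpa using h1.add (hp n)
  refine (tendsto_finsetSum Finset.univ fun n _ => h n).congr fun j => ?_
  simp only [Function.comp]
  rw [Finset.sum_comm, Finset.mul_sum]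

theorem abs_average_le {N : ℕ} {e : ℕ → Fin N → ℝ} {C : ℝ} (hC : 0 ≤ C)
    (he : ∀ t n, |e t n| ≤ C) (T : ℕ) :
    |(1 / (T : ℝ)) * ∑ t ∈ Finset.range T, ∑ n, e t n| ≤ N * C := by
  have h1 : |∑ t ∈ Finset.range T, ∑ n, e t n| ≤ T * (N * C) := by
    refine (Finset.abs_sum_le_sum_abs _ _).trans ?_
    refine (Finset.sum_le_sum fun t _ => (Finset.abs_sum_le_sum_abs _ _).trans
      (Finset.sum_le_sum fun n _ => he t n)).trans ?_
    simp
  rcases Nat.eq_zero_or_pos T with rfl | hT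
  · simpa using mul_nonneg (Nat.cast_nonneg N) hC
  · have hT' : (0 : ℝ) < T := by exact_mod_cast hT
    rw [abs_mul, abs_of_pos (one_div_pos.mpr hT'), one_div, inv_mul_le_iff₀ hT']
    exact h1

namespace Run

variable {N L : ℕ} {A : Fin N → Type u} [∀ n, MeasurableSpace (A n)] {S : Problem N L A}
  {Ω : Type u} [mΩ : MeasurableSpace Ω] {P : Measure Ω} (R : Run S P)
  {B C : ℝ} {φ : ℝ × (Fin L → ℝ) → ℝ}

/-- The measure on actions that counts the expected number of frames starting before `T`. -/
noncomputable def actionMeasure (n : Fin N) (T : ℕ) : Measure (A n) :=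
  ∑ k ∈ Finset.range T, (P.restrict (R.startsBefore n k T)).map (R.action n k)

instance [IsProbabilityMeasure P] (n : Fin N) (T : ℕ) : IsFiniteMeasure (R.actionMeasure n T) := by
  unfold actionMeasure
  infer_instance

theorem frameSum_eq_integral [IsProbabilityMeasure P] (hB0 : 0 ≤ B) (hB : S.ResidualBound B)
    (hφ : Measurable φ) (hC0 : 0 ≤ C) (hC : S.RewardBound φ C) (n : Fin N) (T : ℕ) :
    R.frameSum φ n T = ∫ a, S.totalHat φ n a ∂(R.actionMeasure n T) := by
  rw [actionMeasure, integral_finsetSum_measure fun k _ =>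
    hC.integrable_totalHat hB0 hB hφ hC0 n _]
  refine Finset.sum_congr rfl fun k _ => ?_
  rw [integral_map (R.measurable_action n k).aemeasurable
    (S.measurable_totalHat hφ n).aestronglyMeasurable]

/-- The expected penalties and metrics of system `n` before `T` are, up to a bounded error, `T`
times a point of the convex hull of the performance vectors. -/
theorem exists_mem_convexHull_perfVector [IsProbabilityMeasure P] (hB0 : 0 ≤ B)
    (hB : S.ResidualBound B) (hC0 : 0 ≤ C) (hy : S.RewardBound (fun v => v.1) C)
    (hz : ∀ l, S.RewardBound (fun v => v.2 l) C) (n : Fin N)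
    (hcpt : IsCompact (Set.range (S.perfVector n))) {M : ℝ}
    (hM : ∀ q ∈ convexHull ℝ (Set.range (S.perfVector n)), ‖q‖ ≤ M) {T : ℕ} (hT : 0 < T) :
    ∃ q ∈ convexHull ℝ (Set.range (S.perfVector n)),
      |∑ t ∈ Finset.range T, ∫ ω, R.penalty n t ω ∂P - T * q.1| ≤ (C + M) * B ∧
      ∀ l, |∑ t ∈ Finset.range T, ∫ ω, R.metric n t ω l ∂P - T * q.2 l| ≤ (C + M) * B := by
  set m := R.actionMeasure n T with hm
  have hTpos : ∀ a, 0 < S.THat n a := fun a => zero_lt_one.trans_le (hB.one_le_THat n a)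
  have hTi : Integrable (S.THat n) m :=
    (S.rewardBound_one.integrable_totalHat hB0 hB measurable_const zero_le_one n m).congr
      (Eventually.of_forall (S.totalHat_one n))
  -- Weighting by the expected duration cancels the denominator of `perfVector`: its integral
  -- against `η` gives the expected totals, while the mass `W` of `η` is the expected total duration
  -- of the frames started before `T`.
  let η : Measure (A n) := m.withDensity fun a => ENNReal.ofReal (S.THat n a)
  have hη : ∀ {E : Type} [NormedAddCommGroup E] [NormedSpace ℝ E] (g : A n → E),
      ∫ a, g a ∂η = ∫ a, S.THat n a • g a ∂m := by
    intro E _ _ g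
    rw [integral_withDensity_eq_integral_toReal_smul (S.measurable_THat n).ennreal_ofReal
      (Eventually.of_forall fun _ => ENNReal.ofReal_lt_top)]
    simp only [ENNReal.toReal_ofReal (hTpos _).le]
  have : IsFiniteMeasure η := isFiniteMeasure_withDensity_ofReal hTi.2
  set W := R.frameSum (fun _ => 1) n T with hW
  have hWm : W = ∫ a, S.THat n a ∂m := by
    rw [hW, R.frameSum_eq_integral hB0 hB measurable_const zero_le_one S.rewardBound_one]
    simp only [Problem.totalHat_one, hm]
  have hWT : |W - T| ≤ B := by
    have := R.abs_frameSum_sub_sum_le hB0 hB (φ := fun _ => 1) measurable_const zero_le_one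
      S.rewardBound_one n T
    simpa using this
  have hηW : η.real Set.univ = W := by
    have := hη (fun _ => (1 : ℝ))
    simpa [hWm] using this
  -- Frame `0` starts in slot `0 < T` and lasts at least one slot.
  have hWpos : 0 < W := by
    have h0 : 1 ≤ ∫ ω in R.startsBefore n 0 T, S.totalHat (fun _ => 1) n (R.action n 0 ω) ∂P := by
      have hu : R.startsBefore n 0 T = Set.univ :=
        Set.eq_univ_of_forall fun ω => by simpa [startsBefore, R.renewalTime_zero] using hT
      rw [hu, Measure.restrict_univ, ← integral_map (R.measurable_action n 0).aemeasurable
        (S.measurable_totalHat measurable_const n).aestronglyMeasurable]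
      have : IsProbabilityMeasure (P.map (R.action n 0)) :=
        Measure.isProbabilityMeasure_map (R.measurable_action n 0).aemeasurable
      have h1 := integral_mono (μ := P.map (R.action n 0)) (integrable_const (1 : ℝ))
        (S.rewardBound_one.integrable_totalHat hB0 hB measurable_const zero_le_one n _) fun a => by
            simpa only [Problem.totalHat_one] using hB.one_le_THat n a
      simpa using h1
    have h1 : ∀ k ∈ Finset.range T,
        0 ≤ ∫ ω in R.startsBefore n k T, S.totalHat (fun _ => 1) n (R.action n k ω) ∂P :=
      fun k _ => integral_nonneg fun ω => by
        simpa only [Problem.totalHat_one, Pi.zero_apply] using (hTpos _).le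
    exact zero_lt_one.trans_le
      (h0.trans (Finset.single_le_sum h1 (Finset.mem_range.mpr hT)))
  have : NeZero η := ⟨fun h => by rw [h] at hηW; simp at hηW; exact hWpos.ne hηW⟩
  have hpi : Integrable (S.perfVector n) η := by
    refine Integrable.of_bound (S.measurable_perfVector n).aestronglyMeasurable M ?_
    exact Eventually.of_forall fun a => hM _ (subset_convexHull ℝ _ ⟨a, rfl⟩)
  -- An average over a probability measure stays in a closed convex set; the hull is closed because
  -- it is compact.
  have hq := (convex_convexHull ℝ (Set.range (S.perfVector n))).average_mem
    (isCompact_convexHull_of_isCompact hcpt).isClosed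
    (Eventually.of_forall fun a => subset_convexHull ℝ _ ⟨a, rfl⟩) hpi
  set q := ⨍ a, S.perfVector n a ∂η with hqdef
  have hWq : W • q = ∫ a, S.perfVector n a ∂η := by
    rw [hqdef, average_eq, hηW, smul_smul, mul_inv_cancel₀ hWpos.ne', one_smul]
  have h1 : W * q.1 = ∫ a, (S.perfVector n a).1 ∂η := by
    rw [← fst_integral hpi, ← hWq]; rfl
  have h2 : ∀ l, W * q.2 l = ∫ a, (S.perfVector n a).2 l ∂η := by
    intro l
    rw [← eval_integral fun i => ?_, ← snd_integral hpi, ← hWq]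
    · rfl
    · exact (ContinuousLinearMap.proj (R := ℝ) (φ := fun _ : Fin L => ℝ) i).integrable_comp hpi.snd
  have h1' : W * q.1 = R.frameSum (fun v => v.1) n T := by
    rw [h1, hη, R.frameSum_eq_integral hB0 hB measurable_fst hC0 hy]
    exact integral_congr_ae (Eventually.of_forall fun a => mul_div_cancel₀ _ (hTpos a).ne')
  have h2' : ∀ l, W * q.2 l = R.frameSum (fun v => v.2 l) n T := by
    intro l
    rw [h2, hη, R.frameSum_eq_integral (φ := fun v => v.2 l) hB0 hB
      ((measurable_pi_apply l).comp measurable_snd) hC0 (hz l)]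
    exact integral_congr_ae (Eventually.of_forall fun a => mul_div_cancel₀ _ (hTpos a).ne')
  -- Replacing `W` by `T` costs `|W - T| * |x| ≤ B * M`, on top of the overshoot error `C * B`.
  have key : ∀ x s : ℝ, |x| ≤ M → |W * x - s| ≤ C * B → |s - T * x| ≤ (C + M) * B := by
    intro x s hx hs
    have : s - T * x = -(W * x - s) + (W - T) * x := by ring
    rw [this]
    refine (abs_add_le _ _).trans ?_
    rw [abs_neg, abs_mul, add_mul, mul_comm M B]
    exact add_le_add hs (mul_le_mul hWT hx (abs_nonneg _) hB0)
  refine ⟨q, hq, key _ _ ((norm_fst_le q).trans (hM q hq)) ?_, fun l => key _ _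
    ((norm_le_pi_norm q.2 l).trans ((norm_snd_le q).trans (hM q hq))) ?_⟩
  · rw [h1']
    exact R.abs_frameSum_sub_sum_le hB0 hB measurable_fst hC0 hy n T
  · rw [h2']
    exact R.abs_frameSum_sub_sum_le hB0 hB ((measurable_pi_apply l).comp measurable_snd) hC0
      (hz l) n T

/-- The time averages of a run dominate a point of the convex hulls of the performance vectors. -/
theorem exists_le_avg [IsProbabilityMeasure P] (hB0 : 0 ≤ B) (hB : S.ResidualBound B)
    (hC0 : 0 ≤ C) (hy : S.RewardBound (fun v => v.1) C)
    (hz : ∀ l, S.RewardBound (fun v => v.2 l) C)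
    (hcpt : ∀ n, IsCompact (Set.range (S.perfVector n))) :
    ∃ p : Fin N → ℝ × (Fin L → ℝ), (∀ n, p n ∈ convexHull ℝ (Set.range (S.perfVector n))) ∧
      ∑ n, (p n).1 ≤ R.avgPenalty ∧ ∀ l, ∑ n, (p n).2 l ≤ R.avgMetric l := by
  have hK : ∀ n, IsCompact (convexHull ℝ (Set.range (S.perfVector n))) := fun n =>
    isCompact_convexHull_of_isCompact (hcpt n)
  choose M hM using fun n => (hK n).isBounded.exists_norm_le
  -- Horizons are shifted to `T + 1` to keep them positive.
  choose q hq hq1 hq2 using fun (T : ℕ) n =>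
    R.exists_mem_convexHull_perfVector hB0 hB hC0 hy hz n (hcpt n) (hM n) T.succ_pos
  -- Compactness of the product gives one subsequence for all systems and coordinates, so the same
  -- `p` serves the penalty and every constraint.
  obtain ⟨p, hp, ψ, hψ, hlim⟩ := (isCompact_univ_pi hK).tendsto_subseq
    (x := q) fun T n _ => hq T n
  -- One error bound for all systems; the absolute values make each term at most the sum, whatever
  -- the sign of `M n`.
  let K : ℝ := ∑ n, |(C + M n) * B|
  have hle : ∀ n, (C + M n) * B ≤ K := fun n => (le_abs_self _).trans
    (Finset.single_le_sum (f := fun n => |(C + M n) * B|) (fun _ _ => abs_nonneg _)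
      (Finset.mem_univ n))
  have hψ' : Tendsto (fun j => ψ j + 1) atTop atTop :=
    (tendsto_add_atTop_nat 1).comp hψ.tendsto_atTop
  have hlim' : ∀ n, Tendsto (fun j => q (ψ j) n) atTop (nhds (p n)) := fun n =>
    ((continuous_apply n).tendsto p).comp hlim
  refine ⟨p, fun n => hp n trivial, ?_, fun l => ?_⟩
  · refine le_limsup_of_tendsto_subseq (abs_average_le hC0 fun t n =>
      R.abs_integral_slot_le measurable_fst hy n t) hψ' ?_
    exact tendsto_average_of_abs_sub_le hψ' (fun j => Nat.succ_pos _)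
      (fun j n => (hq1 (ψ j) n).trans (hle n))
      fun n => (continuous_fst.tendsto _).comp (hlim' n)
  · refine le_limsup_of_tendsto_subseq (abs_average_le hC0 fun t n =>
      R.abs_integral_slot_le ((measurable_pi_apply l).comp measurable_snd) (hz l) n t) hψ' ?_
    exact tendsto_average_of_abs_sub_le hψ' (fun j => Nat.succ_pos _)
      (fun j n => (hq2 (ψ j) n l).trans (hle n))
      fun n => (((continuous_apply l).comp continuous_snd).tendsto _).comp (hlim' n)

end Run

/-! ### Runs with independent, identically distributed actions -/

namespace Problem

variable {N L : ℕ} {A : Fin N → Type u} [∀ n, MeasurableSpace (A n)] (S : Problem N L A)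

/-- The coordinates of the canonical space: the action and outcome of the `k`-th frame of system
`n` for every pair `(n, k)`, and the external vector of every slot. -/
def Coord (L : ℕ) (A : Fin N → Type u) : (Fin N × ℕ) ⊕ ℕ → Type u
  | Sum.inl i => A i.1 × FrameOutcome L
  | Sum.inr _ => ULift.{u} (Fin L → ℝ)

instance instMeasurableSpaceCoord : ∀ i, MeasurableSpace (Coord L A i)
  | Sum.inl i => inferInstanceAs (MeasurableSpace (A i.1 × FrameOutcome L))
  | Sum.inr _ => inferInstanceAs (MeasurableSpace (ULift.{u} (Fin L → ℝ)))

/-- The canonical space of runs with independent frames. -/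
abbrev Canonical (L : ℕ) (A : Fin N → Type u) : Type u := ∀ i, Coord L A i

/-- The laws of the coordinates if the actions of system `n` have law `μ n`. -/
noncomputable def coordLaw (μ : ∀ n, Measure (A n)) : ∀ i, Measure (Coord L A i)
  | Sum.inl i => (μ i.1 ⊗ₘ S.frameLaw i.1 : Measure (A i.1 × FrameOutcome L))
  | Sum.inr _ => (S.externalLaw.map ULift.up : Measure (ULift.{u} (Fin L → ℝ)))

instance instIsProbabilityMeasureCoordLaw (μ : ∀ n, Measure (A n))
    [∀ n, IsProbabilityMeasure (μ n)] : ∀ i, IsProbabilityMeasure (S.coordLaw μ i)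
  | Sum.inl i => inferInstanceAs (IsProbabilityMeasure (μ i.1 ⊗ₘ S.frameLaw i.1))
  | Sum.inr _ => Measure.isProbabilityMeasure_map (μ := S.externalLaw)
      measurable_up.aemeasurable

/-- The law of the canonical run. -/
noncomputable def canonicalLaw (μ : ∀ n, Measure (A n)) [∀ n, IsProbabilityMeasure (μ n)] :
    Measure (Canonical L A) := Measure.infinitePi (S.coordLaw μ)

instance (μ : ∀ n, Measure (A n)) [∀ n, IsProbabilityMeasure (μ n)] :
    IsProbabilityMeasure (S.canonicalLaw μ) := by
  unfold canonicalLaw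
  infer_instance

end Problem

/-! ### The canonical run with independent frames, and its filtration -/

namespace Canonical

open Problem

variable {N L : ℕ} {A : Fin N → Type u}

/-- The action and the outcome of the `k`-th frame of system `n`. -/
def pair (n : Fin N) (k : ℕ) (ω : Canonical L A) : A n × FrameOutcome L := ω (Sum.inl (n, k))

/-- The external vector of slot `t`. -/
def ext (t : ℕ) (ω : Canonical L A) : Fin L → ℝ :=
  ULift.down (show ULift.{u} (Fin L → ℝ) from ω (Sum.inr t))

/-- The first slot of the `k`-th frame of system `n`. -/
def start (n : Fin N) (k : ℕ) (ω : Canonical L A) : ℕ :=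
  ∑ j ∈ Finset.range k, (pair n j ω).2.duration

/-- The contribution of the frames in `s` to the penalty and metrics in slot `t`. -/
noncomputable def slotSum (n : Fin N) (t : ℕ) (s : Finset ℕ) (ω : Canonical L A) :
    ℝ × (Fin L → ℝ) :=
  ∑ j ∈ s, if start n j ω ≤ t then (pair n j ω).2.slot (t - start n j ω) else 0

/-- The penalty and the metrics of system `n` in slot `t`. -/
noncomputable def slot (n : Fin N) (t : ℕ) (ω : Canonical L A) : ℝ × (Fin L → ℝ) :=
  -- The `j`-th frame starts in slot `j` or later, so only frames `0, …, t` can meet slot `t`.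
  slotSum n t (Finset.range (t + 1)) ω

theorem start_succ (n : Fin N) (k : ℕ) (ω : Canonical L A) :
    start n (k + 1) ω = start n k ω + (pair n k ω).2.duration := Finset.sum_range_succ _ _

theorem start_lt (n : Fin N) (k : ℕ) (ω : Canonical L A) :
    start n k ω < start n (k + 1) ω := by
  rw [start_succ]
  exact Nat.lt_add_of_pos_right (FrameOutcome.duration_pos _)

theorem strictMono_start (n : Fin N) (ω : Canonical L A) : StrictMono fun k => start n k ω :=
  strictMono_nat_of_lt_succ fun k => start_lt n k ω

/-- Frames starting after slot `t` contribute nothing. Hence, on this event, slot `t` is a function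
of the frames before the `k`-th, as measurability with respect to `frameAlg n k` demands. -/
theorem slotSum_eq_filter {n : Fin N} {t k : ℕ} {ω : Canonical L A} (h : t + 1 ≤ start n k ω)
    (s : Finset ℕ) : slotSum n t s ω = slotSum n t {j ∈ s | j < k} ω := by
  unfold slotSum
  rw [Finset.sum_filter]
  refine Finset.sum_congr rfl fun j _ => ?_
  split_ifs with h1 h2 h2
  · rfl
  · have h3 : start n k ω ≤ start n j ω := (strictMono_start n ω).monotone (not_lt.mp h2)
    omega
  · rfl
  · rfl

/-- Earlier frames are over and contribute their zero padding; later ones have not begun. Only the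
`k`-th term survives. -/
theorem slot_start_add (n : Fin N) (k i : ℕ) (ω : Canonical L A)
    (hi : i < (pair n k ω).2.duration) :
    slot n (start n k ω + i) ω = (pair n k ω).2.slot i := by
  have hk : k ≤ start n k ω := (strictMono_start n ω).id_le k
  unfold slot slotSum
  rw [Finset.sum_eq_single k]
  · simp
  · intro j _ hjk
    split_ifs with h
    · rcases Nat.lt_or_gt_of_ne hjk with h' | h'
      · refine FrameOutcome.slot_eq_zero _ ?_
        have h1 : start n (j + 1) ω ≤ start n k ω :=
          (strictMono_start n ω).monotone (Nat.succ_le_of_lt h')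
        have h2 := start_succ n j ω
        omega
      · have h1 : start n (k + 1) ω ≤ start n j ω :=
          (strictMono_start n ω).monotone (Nat.succ_le_of_lt h')
        have h2 := start_succ n k ω
        omega
    · rfl
  · intro h
    exact absurd (Finset.mem_range.mpr (by omega)) h

theorem observedFrame_eq (n : Fin N) (k : ℕ) (ω : Canonical L A) :
    observedFrame (start n k ω) (start n (k + 1) ω) (start_lt n k ω)
      (fun s => (slot n s ω).1) (fun s => (slot n s ω).2) = (pair n k ω).2 := by
  have hd : start n (k + 1) ω - start n k ω = (pair n k ω).2.duration := by
    rw [start_succ, Nat.add_sub_cancel_left]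
  refine FrameOutcome.ext hd fun i hi => ?_
  have hi' : i < start n (k + 1) ω - start n k ω := hi
  refine (if_pos hi').trans ?_
  exact slot_start_add n k i ω (hd ▸ hi')

variable [∀ n, MeasurableSpace (A n)]

/-- The σ-algebra generated by the `i`-th coordinate. -/
@[reducible]
def coordAlg (i : (Fin N × ℕ) ⊕ ℕ) : MeasurableSpace (Canonical L A) :=
  MeasurableSpace.comap (fun ω => ω i) inferInstance

theorem coordAlg_le (i : (Fin N × ℕ) ⊕ ℕ) :
    coordAlg i ≤ (inferInstance : MeasurableSpace (Canonical L A)) :=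
  (measurable_pi_apply i).comap_le

/-- The information in all coordinates except the frames of system `n` from the `k`-th on. -/
@[reducible]
def frameAlg (n : Fin N) (k : ℕ) : MeasurableSpace (Canonical L A) :=
  ⨆ i ∈ {i | ∀ j, k ≤ j → i ≠ Sum.inl (n, j)}, coordAlg i

/-- The information in all coordinates except the external process from slot `t` on. -/
@[reducible]
def externalAlg (t : ℕ) : MeasurableSpace (Canonical L A) :=
  ⨆ i ∈ {i | ∀ r, t ≤ r → i ≠ Sum.inr r}, coordAlg i

theorem measurable_pair_coordAlg (n : Fin N) (k : ℕ) :
    Measurable[coordAlg (Sum.inl (n, k))] (pair (L := L) (A := A) n k) :=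
  comap_measurable _

theorem measurable_ext_coordAlg (t : ℕ) :
    Measurable[coordAlg (Sum.inr t)] (ext (L := L) (A := A) t) :=
  measurable_down.comp (comap_measurable (fun ω : Canonical L A => ω (Sum.inr t)))

theorem measurable_pair (n : Fin N) (k : ℕ) : Measurable (pair (L := L) (A := A) n k) :=
  (measurable_pair_coordAlg n k).mono (coordAlg_le _) le_rfl

theorem measurable_start {M : MeasurableSpace (Canonical L A)} {n : Fin N} {k : ℕ}
    (h : ∀ j < k, Measurable[M] (pair (L := L) (A := A) n j)) :
    Measurable[M] (start (L := L) (A := A) n k) :=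
  Finset.measurable_sum _ fun j hj => FrameOutcome.measurable_duration.comp
    (measurable_snd.comp (h j (Finset.mem_range.mp hj)))

theorem measurable_slotSum {M : MeasurableSpace (Canonical L A)} {n : Fin N} {t : ℕ}
    {s : Finset ℕ} (h : ∀ j, ∀ k ∈ s, j ≤ k → Measurable[M] (pair (L := L) (A := A) n j)) :
    Measurable[M] (slotSum (L := L) (A := A) n t s) := by
  refine Finset.measurable_sum s fun k hk => ?_
  have h1 : Measurable[M] (start (L := L) (A := A) n k) :=
    measurable_start fun j hj => h j k hk hj.le
  have h2 : Measurable fun p : ℕ × FrameOutcome L => if p.1 ≤ t then p.2.slot (t - p.1) else 0 :=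
    measurable_from_prod_countable_right fun i => by
      by_cases hi : i ≤ t
      · simpa [hi] using FrameOutcome.measurable_slot (t - i)
      · simp [hi]
  exact h2.comp (h1.prodMk (measurable_snd.comp (h k k hk le_rfl)))

theorem measurable_pair_frameAlg {n m : Fin N} {k j : ℕ} (h : m ≠ n ∨ j < k) :
    Measurable[frameAlg n k] (pair (L := L) (A := A) m j) := by
  refine (measurable_pair_coordAlg m j).mono ?_ le_rfl
  refine le_iSup₂_of_le (Sum.inl (m, j)) (fun i hi heq => ?_) le_rfl
  simp only [Sum.inl.injEq, Prod.mk.injEq] at heq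
  rcases h with h | h
  · exact h heq.1
  · omega

theorem measurable_pair_externalAlg (n : Fin N) (k t : ℕ) :
    Measurable[externalAlg t] (pair (L := L) (A := A) n k) :=
  (measurable_pair_coordAlg n k).mono
    (le_iSup₂_of_le (Sum.inl (n, k)) (fun _ _ => Sum.inl_ne_inr) le_rfl) le_rfl

theorem measurable_start_frameAlg {n m : Fin N} {k j : ℕ} (h : m ≠ n ∨ j ≤ k) :
    Measurable[frameAlg n k] (start (L := L) (A := A) m j) :=
  measurable_start fun _ hi => measurable_pair_frameAlg (h.imp_right hi.trans_le)

theorem measurableSet_le_start (n : Fin N) (k t : ℕ) :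
    MeasurableSet[frameAlg n k] {ω : Canonical L A | t ≤ start n k ω} :=
  measurable_start_frameAlg (Or.inr le_rfl) measurableSet_Ici

/-- The information from the slots before `t`: events that do not involve the external process
from slot `t` on, nor, for any system, its frames starting in slot `t` or later. -/
@[reducible]
def historyAlg (L : ℕ) (A : Fin N → Type u) [∀ n, MeasurableSpace (A n)] (t : ℕ) :
    MeasurableSpace (Canonical L A) where
  -- Starting times are random, so the ban on future frames is local: where the `k`-th frame of
  -- system `n` has not begun before `t`, membership in `H` must be decided without the frames of
  -- system `n` from the `k`-th on. Closure under complements holds because that event is itself in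
  -- `frameAlg n k`.
  MeasurableSet' H := MeasurableSet[externalAlg t] H ∧
    ∀ n k, MeasurableSet[frameAlg n k] (H ∩ {ω | t ≤ start n k ω})
  measurableSet_empty := ⟨@MeasurableSet.empty _ (externalAlg t), fun n k => by
    rw [Set.empty_inter]; exact @MeasurableSet.empty _ (frameAlg n k)⟩
  measurableSet_compl H hH := ⟨hH.1.compl, fun n k => by
    have : Hᶜ ∩ {ω : Canonical L A | t ≤ start n k ω} =
        {ω | t ≤ start n k ω} \ (H ∩ {ω | t ≤ start n k ω}) := by
      ext ω; simp only [Set.mem_inter_iff, Set.mem_compl_iff, Set.mem_sdiff]; tauto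
    rw [this]
    exact (measurableSet_le_start n k t).diff (hH.2 n k)⟩
  measurableSet_iUnion H hH := ⟨MeasurableSet.iUnion fun i => (hH i).1, fun n k => by
    rw [Set.iUnion_inter]
    exact MeasurableSet.iUnion fun i => (hH i).2 n k⟩

theorem measurableSet_historyAlg {t : ℕ} {H : Set (Canonical L A)} :
    MeasurableSet[historyAlg L A t] H ↔ MeasurableSet[externalAlg t] H ∧
      ∀ n k, MeasurableSet[frameAlg n k] (H ∩ {ω | t ≤ start n k ω}) := Iff.rfl

theorem externalAlg_le (t : ℕ) :
    externalAlg t ≤ (inferInstance : MeasurableSpace (Canonical L A)) :=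
  iSup₂_le fun i _ => coordAlg_le i

/-- The filtration formed by the σ-algebras `historyAlg`. -/
def history (L : ℕ) (A : Fin N → Type u) [∀ n, MeasurableSpace (A n)] :
    Filtration ℕ (inferInstance : MeasurableSpace (Canonical L A)) where
  seq := historyAlg L A
  mono' s t hst H hH := by
    rw [measurableSet_historyAlg] at hH ⊢
    refine ⟨?_, fun n k => ?_⟩
    · refine (iSup₂_le fun i hi => ?_ : externalAlg s ≤ externalAlg t) _ hH.1
      exact le_iSup₂_of_le i (fun r hr => hi r (hst.trans hr)) le_rfl
    · have : H ∩ {ω : Canonical L A | t ≤ start n k ω} =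
          (H ∩ {ω | s ≤ start n k ω}) ∩ {ω | t ≤ start n k ω} := by
        ext ω
        exact ⟨fun h => ⟨⟨h.1, hst.trans h.2⟩, h.2⟩, fun h => ⟨h.1.1, h.2⟩⟩
      rw [this]
      exact (hH.2 n k).inter (measurableSet_le_start n k t)
  le' t H hH := externalAlg_le t H hH.1

/-- Frames of another system are always available in `frameAlg m k`; for the same system
`slotSum_eq_filter` removes the forbidden ones. -/
theorem measurable_slot_history (n : Fin N) (t : ℕ) :
    Measurable[history L A (t + 1)] (slot (L := L) (A := A) n t) := by
  intro D hD
  refine measurableSet_historyAlg.mpr ⟨?_, fun m k => ?_⟩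
  · exact measurable_slotSum (fun j _ _ _ => measurable_pair_externalAlg n j _) hD
  · by_cases hnm : n = m
    · subst hnm
      have : slot n t ⁻¹' D ∩ {ω : Canonical L A | t + 1 ≤ start n k ω} =
          slotSum n t {j ∈ Finset.range (t + 1) | j < k} ⁻¹' D ∩ {ω | t + 1 ≤ start n k ω} := by
        ext ω
        refine and_congr_left fun h => ?_
        rw [Set.mem_preimage, Set.mem_preimage, slot, slotSum_eq_filter h]
      rw [this]
      refine (measurable_slotSum (fun j i hi hji => measurable_pair_frameAlg (Or.inr ?_)) hD).inter
        (measurableSet_le_start n k _)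
      exact hji.trans_lt (Finset.mem_filter.mp hi).2
    · exact (measurable_slotSum (fun j _ _ _ => measurable_pair_frameAlg (Or.inl hnm)) hD).inter
        (measurableSet_le_start m k _)

/-- For frame `i` of the same system: if `k ≤ i`, the start of frame `k` uses only frames before the
`i`-th; if `i < k`, then `start n k ω ≤ t` is incompatible with `t ≤ start n i ω`. -/
theorem measurableSet_start_history (n : Fin N) (k t : ℕ) :
    MeasurableSet[history L A t] {ω : Canonical L A | start n k ω ≤ t} := by
  refine measurableSet_historyAlg.mpr ⟨?_, fun m i => ?_⟩
  · exact measurable_start (fun j _ => measurable_pair_externalAlg n j _) measurableSet_Iic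
  · by_cases h : n ≠ m ∨ k ≤ i
    · exact (measurable_start_frameAlg h measurableSet_Iic).inter (measurableSet_le_start m i t)
    · push Not at h
      obtain ⟨rfl, h⟩ := h
      convert @MeasurableSet.empty _ (frameAlg n i)
      ext ω
      have h1 : start n i ω < start n k ω := strictMono_start n ω h
      simp only [Set.mem_inter_iff, Set.mem_ofPred_eq, Set.mem_empty_iff_false, iff_false]
      omega

/-- Here the case `i = k` would involve a forbidden action; the strict inequality `start n k ω < t`
makes that case empty. -/
theorem measurableSet_action_history (n : Fin N) (k t : ℕ) {D : Set (A n)}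
    (hD : MeasurableSet D) : MeasurableSet[history L A t]
      {ω : Canonical L A | start n k ω < t ∧ (pair n k ω).1 ∈ D} := by
  refine measurableSet_historyAlg.mpr ⟨?_, fun m i => ?_⟩
  · exact (measurable_start (fun j _ => measurable_pair_externalAlg n j _) measurableSet_Iio).inter
      (measurable_fst.comp (measurable_pair_externalAlg n k _) hD)
  · by_cases h : n ≠ m ∨ k < i
    · exact ((measurable_start_frameAlg (h.imp_right le_of_lt) measurableSet_Iio).inter
        (measurable_fst.comp (measurable_pair_frameAlg h) hD)).inter (measurableSet_le_start m i t)
    · push Not at h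
      obtain ⟨rfl, h⟩ := h
      convert @MeasurableSet.empty _ (frameAlg n i)
      ext ω
      have h1 : start n i ω ≤ start n k ω := (strictMono_start n ω).monotone h
      simp only [Set.mem_inter_iff, Set.mem_ofPred_eq, Set.mem_empty_iff_false, iff_false]
      omega

theorem measurable_ext_history (t : ℕ) :
    Measurable[history L A (t + 1)] (ext (L := L) (A := A) t) := by
  intro D hD
  refine measurableSet_historyAlg.mpr ⟨?_, fun m k => ?_⟩
  · refine ((measurable_ext_coordAlg t).mono ?_ le_rfl) hD
    refine le_iSup₂_of_le (Sum.inr t) (fun r hr h => ?_) le_rfl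
    have := Sum.inr.inj h
    omega
  · refine MeasurableSet.inter ?_ (measurableSet_le_start m k _)
    refine ((measurable_ext_coordAlg t).mono ?_ le_rfl) hD
    exact le_iSup₂_of_le (Sum.inr t) (fun _ _ => Sum.inr_ne_inl) le_rfl

variable (S : Problem N L A) (μ : ∀ n, Measure (A n)) [∀ n, IsProbabilityMeasure (μ n)]

theorem iIndep_coordAlg : iIndep (coordAlg (L := L) (A := A)) (S.canonicalLaw μ) :=
  (iIndepFun_infinitePi (P := S.coordLaw μ) (X := fun _ x => x) fun _ => measurable_id).iIndep

theorem map_pair (n : Fin N) (k : ℕ) :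
    (S.canonicalLaw μ).map (pair n k) = μ n ⊗ₘ S.frameLaw n :=
  Measure.infinitePi_map_eval (S.coordLaw μ) (Sum.inl (n, k))

theorem map_ext (t : ℕ) : (S.canonicalLaw μ).map (ext t) = S.externalLaw := by
  have h1 := Measure.infinitePi_map_eval (S.coordLaw μ) (Sum.inr t)
  have h2 : S.coordLaw μ (Sum.inr t) = S.externalLaw.map (ULift.up.{u}) := rfl
  have h3 : (ext t : Canonical L A → Fin L → ℝ) =
      (ULift.down.{u} : ULift.{u} (Fin L → ℝ) → _) ∘ fun ω : Canonical L A => ω (Sum.inr t) := rfl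
  rw [h3]
  refine (Measure.map_map measurable_down (measurable_pi_apply _)).symm.trans ?_
  refine (congrArg (Measure.map ULift.down) (h1.trans h2)).trans ?_
  exact (Measure.map_map (μ := S.externalLaw) measurable_down measurable_up).trans Measure.map_id

theorem indep_ext (t : ℕ) : Indep (MeasurableSpace.comap (ext (L := L) (A := A) t) inferInstance)
    (history L A t) (S.canonicalLaw μ) := by
  have h := indep_iSup_of_disjoint coordAlg_le (iIndep_coordAlg S μ)
    (S := {Sum.inr t}) (T := {i | ∀ r, t ≤ r → i ≠ Sum.inr r})
    (Set.disjoint_singleton_left.mpr fun h => h t le_rfl rfl)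
  rw [iSup_singleton] at h
  exact indep_of_indep_of_le_left (indep_of_indep_of_le_right h fun H hH => hH.1)
    (measurable_ext_coordAlg t).comap_le

/-- On an event that does not involve the frames of system `n` from the `k`-th on, the `k`-th
frame has its usual law. -/
theorem map_restrict_pair {n : Fin N} {k : ℕ} {H : Set (Canonical L A)}
    (hH : MeasurableSet[frameAlg n k] H) : ((S.canonicalLaw μ).restrict H).map (pair n k) =
      S.canonicalLaw μ H • (μ n ⊗ₘ S.frameLaw n) := by
  have h := indep_iSup_of_disjoint coordAlg_le (iIndep_coordAlg S μ)
    (S := {Sum.inl (n, k)}) (T := {i | ∀ j, k ≤ j → i ≠ Sum.inl (n, j)})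
    (Set.disjoint_singleton_left.mpr fun h => h k le_rfl rfl)
  rw [iSup_singleton, Indep_iff] at h
  ext E hE
  rw [Measure.map_apply (measurable_pair n k) hE,
    Measure.restrict_apply (measurable_pair n k hE),
    h _ H (measurable_pair_coordAlg n k hE) hH, Measure.smul_apply, smul_eq_mul, mul_comm,
    ← map_pair S μ n k, Measure.map_apply (measurable_pair n k) hE]

theorem map_restrict_action {n : Fin N} {k : ℕ} {H : Set (Canonical L A)}
    (hH : MeasurableSet[frameAlg n k] H) :
    ((S.canonicalLaw μ).restrict H).map (fun ω => (pair n k ω).1) =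
      S.canonicalLaw μ H • μ n := by
  have := congrArg (Measure.map Prod.fst) (map_restrict_pair S μ hH)
  rw [Measure.map_map measurable_fst (measurable_pair n k), Measure.map_smul] at this
  rw [show (fun ω : Canonical L A => (pair n k ω).1) = Prod.fst ∘ pair n k from rfl, this]
  congr 1
  exact Measure.fst_compProd _ _

/-- The run in which all frames are independent, the actions of system `n` having law `μ n`. -/
noncomputable def run : Run S (S.canonicalLaw μ) where
  action n k ω := (pair n k ω).1
  renewalTime := start
  penalty n t ω := (slot n t ω).1
  metric n t ω := (slot n t ω).2
  external := ext
  history := history L A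
  renewalTime_zero _ _ := rfl
  renewalTime_lt := start_lt
  measurable_action n k := measurable_fst.comp (measurable_pair n k)
  adapted_renewalTime := measurableSet_start_history
  adapted_action n k t _ hD := measurableSet_action_history n k t hD
  adapted_penalty n t := measurable_fst.comp (measurable_slot_history n t)
  adapted_metric n t := measurable_snd.comp (measurable_slot_history n t)
  adapted_external := measurable_ext_history
  external_law := map_ext S μ
  external_indep := indep_ext S μ
  renewal n k t H D E hH hD hE := by
    simp only [observedFrame_eq]
    set H' : Set (Canonical L A) := H ∩ {ω | start n k ω = t} with hH'
    -- The definition of the history gives this for `H` on `t ≤ start n k ω`, and the start depends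
    -- only on frames before the `k`-th. So `H'` is independent of the `k`-th frame.
    have hH'm : MeasurableSet[frameAlg n k] H' := by
      have : H' = (H ∩ {ω | t ≤ start n k ω}) ∩ {ω | start n k ω ≤ t} := by
        ext ω
        simp only [hH', Set.mem_inter_iff, Set.mem_ofPred_eq, and_assoc, le_antisymm_iff]
        tauto
      rw [this]
      exact (hH.2 n k).inter (measurable_start_frameAlg (Or.inr le_rfl) measurableSet_Iic)
    have hm : Measurable fun ω : Canonical L A => (pair n k ω).1 :=
      measurable_fst.comp (measurable_pair n k)
    have h1 : {ω : Canonical L A | ω ∈ H ∧ start n k ω = t ∧ (pair n k ω).1 ∈ D ∧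
        (pair n k ω).2 ∈ E} = pair n k ⁻¹' (D ×ˢ E) ∩ H' := by
      ext ω
      simp only [hH', Set.mem_inter_iff, Set.mem_ofPred_eq, Set.mem_preimage, Set.mem_prod]
      tauto
    have h2 : {ω : Canonical L A | ω ∈ H ∧ start n k ω = t ∧ (pair n k ω).1 ∈ D} =
        (fun ω => (pair n k ω).1) ⁻¹' D ∩ H' := by
      ext ω
      simp only [hH', Set.mem_inter_iff, Set.mem_ofPred_eq, Set.mem_preimage]
      tauto
    rw [h1, h2, ← Measure.restrict_restrict (hm hD),
      ← Measure.restrict_apply (measurable_pair n k (hD.prod hE)),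
      ← Measure.map_apply (measurable_pair n k) (hD.prod hE), map_restrict_pair S μ hH'm,
      ← setLIntegral_map hD (Kernel.measurable_coe (S.frameLaw n) hE) hm,
      map_restrict_action S μ hH'm, Measure.smul_apply, Measure.compProd_apply_prod hD hE,
      Measure.restrict_smul, lintegral_smul_measure]

end Canonical

/-! ### Random actions and centred rewards -/

namespace Problem

variable {N L : ℕ} {A : Fin N → Type u} [∀ n, MeasurableSpace (A n)] {S : Problem N L A}
  {B C : ℝ} {φ : ℝ × (Fin L → ℝ) → ℝ}

theorem measurable_metric (l : Fin L) : Measurable fun v : ℝ × (Fin L → ℝ) => v.2 l :=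
  (measurable_pi_apply l).comp measurable_snd

/-- Every point of the hull of the one-frame expectations is the vector of one-frame expectations
under a random action. -/
theorem exists_action_law (hB0 : 0 ≤ B) (hB : S.ResidualBound B) (hC0 : 0 ≤ C)
    (hy : S.RewardBound (fun v => v.1) C) (hz : ∀ l, S.RewardBound (fun v => v.2 l) C) (n : Fin N)
    {s : ℝ × (Fin L → ℝ) × ℝ} (hs : s ∈ S.frameHull n) :
    ∃ μ : Measure (A n), IsProbabilityMeasure μ ∧
      ((∫ a, S.yHat n a ∂μ, fun l => ∫ a, S.zHat n a l ∂μ, ∫ a, S.THat n a ∂μ) :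
        ℝ × (Fin L → ℝ) × ℝ) = s := by
  have hyi := fun (μ : Measure (A n)) [IsFiniteMeasure μ] =>
    hy.integrable_totalHat hB0 hB measurable_fst hC0 n μ
  have hzi := fun l (μ : Measure (A n)) [IsFiniteMeasure μ] =>
    (hz l).integrable_totalHat hB0 hB (measurable_metric l) hC0 n μ
  have hTi := fun (μ : Measure (A n)) [IsFiniteMeasure μ] =>
    (S.rewardBound_one.integrable_totalHat hB0 hB measurable_const zero_le_one n μ).congr
      (Eventually.of_forall (S.totalHat_one n))
  let V : Measure (A n) → ℝ × (Fin L → ℝ) × ℝ := fun μ =>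
    (∫ a, S.yHat n a ∂μ, fun l => ∫ a, S.zHat n a l ∂μ, ∫ a, S.THat n a ∂μ)
  -- The vectors attained by random actions form a convex set, by mixing laws, and contain the
  -- generators, by Dirac laws.
  have hsub : S.frameHull n ⊆ V '' {μ | IsProbabilityMeasure μ} := by
    refine convexHull_min ?_ ?_
    · rintro _ ⟨a, rfl⟩
      refine ⟨Measure.dirac a, Measure.dirac.isProbabilityMeasure, ?_⟩
      refine Prod.ext ?_ (Prod.ext (funext fun l => ?_) ?_)
      · exact integral_dirac' _ a (S.measurable_totalHat measurable_fst n).stronglyMeasurable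
      · exact integral_dirac' _ a
          (S.measurable_totalHat (measurable_metric l) n).stronglyMeasurable
      · exact integral_dirac' _ a (S.measurable_THat n).stronglyMeasurable
    · rintro _ ⟨μ, hμ, rfl⟩ _ ⟨ν, hν, rfl⟩ a b ha hb hab
      have hμ' : IsProbabilityMeasure μ := hμ
      have hν' : IsProbabilityMeasure ν := hν
      have hlin : ∀ f : A n → ℝ, Integrable f μ → Integrable f ν →
          ∫ x, f x ∂(ENNReal.ofReal a • μ + ENNReal.ofReal b • ν) =
            a * ∫ x, f x ∂μ + b * ∫ x, f x ∂ν := by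
        intro f hfμ hfν
        rw [integral_add_measure (hfμ.smul_measure ENNReal.ofReal_ne_top)
          (hfν.smul_measure ENNReal.ofReal_ne_top), integral_smul_measure, integral_smul_measure,
          ENNReal.toReal_ofReal ha, ENNReal.toReal_ofReal hb, smul_eq_mul, smul_eq_mul]
      refine ⟨ENNReal.ofReal a • μ + ENNReal.ofReal b • ν, ⟨?_⟩, ?_⟩
      · simp [← ENNReal.ofReal_add ha hb, hab]
      · refine Prod.ext ?_ (Prod.ext (funext fun l => ?_) ?_)
        · exact hlin _ (hyi μ) (hyi ν)
        · exact hlin _ (hzi l μ) (hzi l ν)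
        · exact hlin _ (hTi μ) (hTi ν)
  obtain ⟨μ, hμ, h⟩ := hsub hs
  exact ⟨μ, hμ, h⟩

theorem RewardBound.sub_const (hC : S.RewardBound φ C) (θ : ℝ) :
    S.RewardBound (fun v => φ v - θ) (C + |θ|) := by
  intro n a
  filter_upwards [hC n a] with x hx i hi
  exact (abs_sub _ _).trans (add_le_add_left (hx i hi) _)

/-- Subtracting `θ` in each slot subtracts `θ` times the duration from the frame total. With `θ` the
ratio of the expectations, the mean frame total becomes zero. -/
theorem RewardBound.totalHat_sub_const (hB : S.ResidualBound B) (hφ : Measurable φ)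
    (hC : S.RewardBound φ C) (θ : ℝ) (n : Fin N) (a : A n) :
    S.totalHat (fun v => φ v - θ) n a = S.totalHat φ n a - θ * S.THat n a := by
  rw [totalHat, totalHat, THat, ← integral_const_mul, ← integral_sub
    (hC.integrable_total hB hφ n a) ((hB.integrable_duration n a).const_mul θ)]
  refine integral_congr_ae (Eventually.of_forall fun x => ?_)
  simp only [FrameOutcome.total, Finset.sum_sub_distrib, Finset.sum_const, Finset.card_range,
    nsmul_eq_mul]
  ring

end Problem

/-! ### Time averages of the canonical run -/

namespace Canonical

variable {N L : ℕ} {A : Fin N → Type u} [∀ n, MeasurableSpace (A n)] {S : Problem N L A}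
  {B C : ℝ} {φ : ℝ × (Fin L → ℝ) → ℝ} {μ : ∀ n, Measure (A n)} [∀ n, IsProbabilityMeasure (μ n)]

/-- Wald's identity: the expected reward over the frames that start before `T` is the expected
number of these frames times the expected reward of a frame. -/
theorem frameSum_run (hφ : Measurable φ) (n : Fin N) (T : ℕ) :
    (run S μ).frameSum φ n T = (∑ k ∈ Finset.range T,
      (S.canonicalLaw μ).real ((run S μ).startsBefore n k T)) * ∫ a, S.totalHat φ n a ∂(μ n) := by
  rw [Run.frameSum, Finset.sum_mul]
  refine Finset.sum_congr rfl fun k _ => ?_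
  -- The start of the `k`-th frame is determined by earlier frames, so its action is independent of
  -- this event.
  have hm : MeasurableSet[frameAlg n k] ((run S μ).startsBefore n k T) :=
    measurable_start_frameAlg (Or.inr le_rfl) measurableSet_Iio
  rw [← integral_map ((run S μ).measurable_action n k).aemeasurable
    (S.measurable_totalHat hφ n).aestronglyMeasurable]
  refine (congrArg (fun ν => ∫ a, S.totalHat φ n a ∂ν) (map_restrict_action S μ hm)).trans ?_
  rw [integral_smul_measure]
  rfl

/-- The expected reward of the canonical run before `T` is `θ T` up to a bounded error, where `θ`
is the ratio of the expected reward and the expected duration of a frame. -/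
theorem abs_sum_slot_run_sub_le (hB0 : 0 ≤ B) (hB : S.ResidualBound B) (hφ : Measurable φ)
    (hC0 : 0 ≤ C) (hC : S.RewardBound φ C) {n : Fin N} {θ : ℝ}
    (hθ : ∫ a, S.totalHat φ n a ∂(μ n) = θ * ∫ a, S.THat n a ∂(μ n)) (T : ℕ) :
    |∑ t ∈ Finset.range T, ∫ ω, φ ((run S μ).slot n t ω) ∂(S.canonicalLaw μ) - T * θ| ≤
      (C + |θ|) * B := by
  have hφ' : Measurable fun v => φ v - θ := hφ.sub_const θ
  have h := (run S μ).abs_frameSum_sub_sum_le hB0 hB hφ' (by positivity) (hC.sub_const θ) n T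
  -- The centred reward has mean frame total zero, so its frame sum vanishes by Wald's identity
  -- whatever the expected number of frames; no renewal theorem is needed.
  have h0 : ∫ a, S.totalHat (fun v => φ v - θ) n a ∂(μ n) = 0 := by
    simp only [hC.totalHat_sub_const hB hφ]
    rw [integral_sub (hC.integrable_totalHat hB0 hB hφ hC0 n _), integral_const_mul, hθ, sub_self]
    exact ((S.rewardBound_one.integrable_totalHat hB0 hB measurable_const zero_le_one n _).congr
      (Eventually.of_forall (S.totalHat_one n))).const_mul θ
  rw [frameSum_run hφ', h0, mul_zero, zero_sub, abs_neg] at h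
  refine le_of_eq_of_le (congrArg abs ?_) h
  have : ∀ t, ∫ ω, (φ ((run S μ).slot n t ω) - θ) ∂(S.canonicalLaw μ) =
      ∫ ω, φ ((run S μ).slot n t ω) ∂(S.canonicalLaw μ) - θ := fun t => by
    rw [integral_sub ((run S μ).integrable_slot hφ hC n t) (integrable_const _)]
    simp
  simp only [this]
  simp

end Canonical

/-! ### Attaining points of the performance regions -/

namespace Problem

variable {N L : ℕ} {A : Fin N → Type u} [∀ n, MeasurableSpace (A n)] {S : Problem N L A}
  {B C : ℝ}

/-- Every choice of points of the performance regions is attained by the time averages of a run. -/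
theorem exists_run_of_mem_region (hB0 : 0 ≤ B) (hB : S.ResidualBound B) (hC0 : 0 ≤ C)
    (hy : S.RewardBound (fun v => v.1) C) (hz : ∀ l, S.RewardBound (fun v => v.2 l) C)
    {p : Fin N → ℝ × (Fin L → ℝ)} (hp : ∀ n, p n ∈ S.region n) :
    ∃ (Ω : Type u) (_ : MeasurableSpace Ω) (P : Measure Ω) (_ : IsProbabilityMeasure P)
      (R : Run S P), R.avgPenalty = ∑ n, (p n).1 ∧ ∀ l, R.avgMetric l = ∑ n, (p n).2 l := by
  choose s hs hsp using hp
  choose μ hμ hμs using fun n => exists_action_law hB0 hB hC0 hy hz n (hs n)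
  have hT : ∀ n, (s n).2.2 ≠ 0 := by
    intro n
    have h1 : (1 : ℝ) ≤ (s n).2.2 := by
      rw [← hμs n]
      have := integral_mono (μ := μ n) (integrable_const (1 : ℝ))
        ((S.rewardBound_one.integrable_totalHat hB0 hB measurable_const zero_le_one n _).congr
          (Eventually.of_forall (S.totalHat_one n))) fun a => hB.one_le_THat n a
      simpa using this
    linarith
  have key : ∀ (φ : ℝ × (Fin L → ℝ) → ℝ), Measurable φ → S.RewardBound φ C → ∀ θ : Fin N → ℝ,
      (∀ n, ∫ a, S.totalHat φ n a ∂(μ n) = θ n * ∫ a, S.THat n a ∂(μ n)) →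
      limsup (fun T : ℕ => (1 / (T : ℝ)) * ∑ t ∈ Finset.range T, ∑ n,
        ∫ ω, φ ((Canonical.run S μ).slot n t ω) ∂(S.canonicalLaw μ)) atTop = ∑ n, θ n := by
    intro φ hφ hC θ hθ
    refine Tendsto.limsup_eq ((tendsto_add_atTop_iff_nat 1).mp ?_)
    refine tendsto_average_of_abs_sub_le (q := fun _ n => θ n) (tendsto_add_atTop_nat 1)
      (fun j => j.succ_pos) (K := ∑ n, (C + |θ n|) * B) (fun j n => ?_)
      fun n => tendsto_const_nhds
    refine (Canonical.abs_sum_slot_run_sub_le hB0 hB hφ hC0 hC (hθ n) (j + 1)).trans ?_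
    exact Finset.single_le_sum (f := fun n => (C + |θ n|) * B) (fun _ _ => by positivity)
      (Finset.mem_univ n)
  refine ⟨Canonical L A, inferInstance, S.canonicalLaw μ, inferInstance, Canonical.run S μ,
    key (fun v => v.1) measurable_fst hy (fun n => (p n).1) fun n => ?_, fun l =>
    key (fun v => v.2 l) (measurable_metric l) (hz l) (fun n => (p n).2 l) fun n => ?_⟩
  · have h1 : ∫ a, S.totalHat (fun v => v.1) n a ∂(μ n) = (s n).1 := congrArg Prod.fst (hμs n)
    have h2 : ∫ a, S.THat n a ∂(μ n) = (s n).2.2 := congrArg (fun x => x.2.2) (hμs n)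
    rw [h1, h2, ← hsp n]
    exact (div_mul_cancel₀ _ (hT n)).symm
  · have h1 : ∫ a, S.totalHat (fun v => v.2 l) n a ∂(μ n) = (s n).2.1 l :=
      congrArg (fun x => x.2.1 l) (hμs n)
    have h2 : ∫ a, S.THat n a ∂(μ n) = (s n).2.2 := congrArg (fun x => x.2.2) (hμs n)
    rw [h1, h2, ← hsp n]
    exact (div_mul_cancel₀ _ (hT n)).symm

/-- The uniform bounds that follow from the boundedness assumption. -/
theorem Bounded.exists_bounds (h : S.Bounded) : ∃ B C : ℝ, 0 ≤ B ∧ S.ResidualBound B ∧ 0 ≤ C ∧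
    S.RewardBound (fun v => v.1) C ∧ ∀ l, S.RewardBound (fun v => v.2 l) C := by
  obtain ⟨⟨y, hy⟩, ⟨z, hz⟩, -, B, hB1, hB⟩ := h
  -- The given bounds may be negative when vacuous, for example if `N = 0`; hence the `0`.
  refine ⟨B, max 0 (max y z), zero_le_one.trans hB1, S.residualBound_of_secondMoment hB,
    le_max_left _ _, fun n a => ?_, fun l n a => ?_⟩
  · filter_upwards [hy n a] with x hx i hi
    exact (hx i hi).trans ((le_max_left _ _).trans (le_max_right _ _))
  · filter_upwards [hz n a] with x hx i hi
    exact (hx i hi l).trans ((le_max_right _ _).trans (le_max_right _ _))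

end Problem

end AsyncRenewal

/-! ### The minimizer and the optimal value -/

theorem mainTheorem3 {N L : ℕ} {A : Fin N → Type*} [∀ n, MeasurableSpace (A n)]
    (S : AsyncRenewal.Problem N L A)
    (hfeas : S.Feasible)
    (hbdd : S.Bounded)
    (hcpt : ∀ n, IsCompact (Set.range (S.perfVector n))) :
    (∃ p : Fin N → ℝ × (Fin L → ℝ),
      (∀ n, p n ∈ S.region n) ∧
      ∑ n, (p n).1 = S.optimalValue ∧
      ∀ l, ∑ n, (p n).2 l ≤ S.dMean l) ∧
    (∀ p : Fin N → ℝ × (Fin L → ℝ),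
      (∀ n, p n ∈ S.region n) →
      (∀ l, ∑ n, (p n).2 l ≤ S.dMean l) →
      S.optimalValue ≤ ∑ n, (p n).1) := by
  obtain ⟨B, C, hB0, hB, hC0, hy, hz⟩ := hbdd.exists_bounds
  -- The minimum is sought over the hulls of the performance vectors, whose compactness follows from
  -- that of the generating sets.
  let Q : Set (Fin N → ℝ × (Fin L → ℝ)) :=
    (Set.univ.pi fun n => convexHull ℝ (Set.range (S.perfVector n))) ∩
      {p | ∀ l, ∑ n, (p n).2 l ≤ S.dMean l}
  have hQ : IsCompact Q := by
    refine (isCompact_univ_pi fun n =>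
      AsyncRenewal.isCompact_convexHull_of_isCompact (hcpt n)).inter_right ?_
    simp only [Set.ofPred_forall]
    exact isClosed_iInter fun l => isClosed_le (by fun_prop) continuous_const
  have hdom : ∀ v ∈ S.feasibleValues, ∃ p ∈ Q, ∑ n, (p n).1 ≤ v := by
    rintro _ ⟨Ω, _, P, _, R, hR, rfl⟩
    obtain ⟨p, hp, hp1, hp2⟩ := R.exists_le_avg hB0 hB hC0 hy hz hcpt
    exact ⟨p, ⟨fun n _ => hp n, fun l => (hp2 l).trans (hR l)⟩, hp1⟩
  have hatt : ∀ p : Fin N → ℝ × (Fin L → ℝ), (∀ n, p n ∈ S.region n) →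
      (∀ l, ∑ n, (p n).2 l ≤ S.dMean l) → ∑ n, (p n).1 ∈ S.feasibleValues := by
    intro p hp hpl
    obtain ⟨Ω, i₁, P, i₂, R, hR, hRl⟩ :=
      AsyncRenewal.Problem.exists_run_of_mem_region hB0 hB hC0 hy hz hp
    exact ⟨Ω, i₁, P, i₂, R, fun l => (hRl l).trans_le (hpl l), hR⟩
  obtain ⟨v₀, hv₀⟩ := hfeas
  obtain ⟨p₀, hp₀, -⟩ := hdom v₀ hv₀
  obtain ⟨p, hp, hmin⟩ := hQ.exists_isMinOn ⟨p₀, hp₀⟩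
    (f := fun p : Fin N → ℝ × (Fin L → ℝ) => ∑ n, (p n).1) (by fun_prop)
  have hlb : ∀ v ∈ S.feasibleValues, ∑ n, (p n).1 ≤ v := fun v hv => by
    obtain ⟨q, hq, hqv⟩ := hdom v hv
    exact (hmin hq).trans hqv
  have hpr : ∀ n, p n ∈ S.region n := fun n => hB.convexHull_subset_region n (hp.1 n trivial)
  -- The minimizer is realized by a run because hulls lie in regions, and every feasible run
  -- dominates a point of `Q`.
  have hleast : IsLeast S.feasibleValues (∑ n, (p n).1) := ⟨hatt p hpr hp.2, hlb⟩
  have hopt : S.optimalValue = ∑ n, (p n).1 := hleast.csInf_eq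
  refine ⟨⟨p, hpr, hopt.symm, hp.2⟩, fun q hq hql => ?_⟩
  rw [hopt]
  exact hlb _ (hatt q hq hql)
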